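/- Let $\gamma, v_0, V^0>0$ and let $g:[0,\infty)\to\mathbb R$ be decreasing and differentiable with bounded derivative and $-V^0\le g\le -v_0$. For a bounded continuous $u_0\ge 0$ on $\mathbb R$ consider the free-interface problem $$u_t=u_{xx}-\gamma u\ \ (x\neq s(t),\ t>0),\qquad u(x,0)=u_0(x),$$ $$g(u(s(t),t))=v(t),\qquad u_x^+(s(t),t)-u_x^-(s(t),t)=v(t),\qquad s(t)=\int_0^t v(\tau)\,d\tau .$$ By a solution we mean a classical one: $v$ is continuous on $[0,\infty)$; $u\ge0$ is bounded and continuous on $\mathbb R\times[0,\infty)$; $u_x,u_{xx},u_t$ exist and are continuous off the interface for $t>0$; and $u_x$ has limits at the interface from either side for $t>0$. Let $T(t)$, $t\ge 0$, be the solution semigroup in the frame attached to the interface: $T(t)u_0=\varphi$ means that $\varphi(x)=u(x+s(t),t)$ for all $x$, where $u$ is a solution with initial datum $u_0$ and interface position $s$. For $\alpha\ge0$ put $|f|_\alpha=\sup_x e^{\alpha|x|}|f(x)|$ and $C_\alpha=\{f\in C(\mathbb R): |f|_\alpha<\infty\}$. Let $0\le\alpha<\min\left(\alpha_{time},\ \frac{v_0}{4},\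 \frac{\gamma}{2V^0}\right)$, where $\alpha_{time}=\frac{V^0}{2}\left(\sqrt{1+4\gamma/(V^0)^2}-1\right)$. Let $\varepsilon>0$, let $B_a=\{f\in C_\alpha: f\ge0,\ |f|_\alpha\le V^0/\sqrt\gamma+\varepsilon\}$ be the absorbing ball, and let the attractor be its $\omega$-limit set $$\mathcal A_\alpha=\bigcap_{r\ge0}\overline{\bigcup_{t\ge r}T(t)B_a}$$ (closure in $C_\alpha$). Then for every $t\ge0$ the map $T(t)$ is one-to-one on $\mathcal A_\alpha$: if $u_1,u_2\in\mathcal A_\alpha$ and $T(t)u_1=T(t)u_2$, then $u_1=u_2$. -/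

import Mathlib

open Set Filter Topology

noncomputable section

namespace FreeInterface

/-- Admissible kinetic functions: `g` is differentiable and decreasing on `[0, ∞)`, has a bounded
derivative there, and takes values in `[-V₀, -v₀]`. Values of `g` at negative temperatures are
irrelevant. -/
structure IsKinetics (v₀ V₀ : ℝ) (g : ℝ → ℝ) : Prop where
  antitone : AntitoneOn g (Ici 0)
  differentiable : DifferentiableOn ℝ g (Ici 0)
  deriv_bounded : ∃ C : ℝ, ∀ y ∈ Ici (0 : ℝ), |derivWithin g (Ici 0) y| ≤ C
  lower : ∀ y ∈ Ici (0 : ℝ), -V₀ ≤ g y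
  upper : ∀ y ∈ Ici (0 : ℝ), g y ≤ -v₀

/-- The interface position `s(t) = ∫₀ᵗ v(τ) dτ`. -/
def front (v : ℝ → ℝ) (t : ℝ) : ℝ := ∫ τ in (0 : ℝ)..t, v τ

/-- The derivative `u_x(x, t)`. -/
def dx (u : ℝ → ℝ → ℝ) (x t : ℝ) : ℝ := deriv (fun y => u y t) x

/-- The derivative `u_xx(x, t)`. -/
def dxx (u : ℝ → ℝ → ℝ) (x t : ℝ) : ℝ := deriv (fun y => dx u y t) x

/-- The derivative `u_t(x, t)`. -/
def dt (u : ℝ → ℝ → ℝ) (x t : ℝ) : ℝ := deriv (fun τ => u x τ) t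

/-- The points `(x, t)` with `t > 0` off the interface. -/
def offFront (v : ℝ → ℝ) : Set (ℝ × ℝ) := {p | 0 < p.2 ∧ p.1 ≠ front v p.2}

/-- `u` (temperature, in the laboratory frame) and `v` (interface velocity) form a classical
solution, global in time, of the free-interface problem
`u_t = u_xx - γ u` for `x ≠ s(t)`, `u(x, 0) = u₀(x)`, `g(u(s(t), t)) = v(t)`,
`u_x⁺(s(t), t) - u_x⁻(s(t), t) = v(t)`, with `s(t) = ∫₀ᵗ v`.
The temperature is nonnegative and bounded. -/
structure IsClassicalSolution (γ : ℝ) (g : ℝ → ℝ) (u₀ : ℝ → ℝ) (u : ℝ → ℝ → ℝ) (v : ℝ → ℝ) :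
    Prop where
  continuous_u : ContinuousOn (fun p : ℝ × ℝ => u p.1 p.2) {p | 0 ≤ p.2}
  continuous_v : ContinuousOn v (Ici 0)
  nonneg : ∀ x t, 0 ≤ t → 0 ≤ u x t
  bounded : ∃ M : ℝ, ∀ x t, 0 ≤ t → u x t ≤ M
  differentiable_x : ∀ p ∈ offFront v, DifferentiableAt ℝ (fun y => u y p.2) p.1
  differentiable_xx : ∀ p ∈ offFront v, DifferentiableAt ℝ (fun y => dx u y p.2) p.1
  differentiable_t : ∀ p ∈ offFront v, DifferentiableAt ℝ (fun τ => u p.1 τ) p.2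
  continuous_dx : ContinuousOn (fun p : ℝ × ℝ => dx u p.1 p.2) (offFront v)
  continuous_dxx : ContinuousOn (fun p : ℝ × ℝ => dxx u p.1 p.2) (offFront v)
  continuous_dt : ContinuousOn (fun p : ℝ × ℝ => dt u p.1 p.2) (offFront v)
  heat : ∀ p ∈ offFront v, dt u p.1 p.2 = dxx u p.1 p.2 - γ * u p.1 p.2
  initial : ∀ x, u x 0 = u₀ x
  kinetic : ∀ t, 0 < t → g (u (front v t) t) = v t
  /-- `u_x` has limits at the interface from either side, and they differ by `v`. -/
  jump : ∀ t, 0 < t → ∃ left right : ℝ,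
    Tendsto (fun p : ℝ × ℝ => dx u p.1 p.2)
      (𝓝[{p : ℝ × ℝ | p.1 < front v p.2}] (front v t, t)) (𝓝 left) ∧
    Tendsto (fun p : ℝ × ℝ => dx u p.1 p.2)
      (𝓝[{p : ℝ × ℝ | front v p.2 < p.1}] (front v t, t)) (𝓝 right) ∧
    right - left = v t

/-- The graph of the semigroup: `Evolves γ g t u₀ φ` says `T(t) u₀ = φ`, that is, `φ` is the
temperature profile at time `t`, in the frame attached to the interface, of the solution of the
free-interface problem with initial datum `u₀`. -/
def Evolves (γ : ℝ) (g : ℝ → ℝ) (t : ℝ) (u₀ φ : ℝ → ℝ) : Prop :=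
  ∃ (u : ℝ → ℝ → ℝ) (v : ℝ → ℝ), IsClassicalSolution γ g u₀ u v ∧
    ∀ x, φ x = u (x + front v t) t

/-- The weighted norm `|f|_α = sup_x e^{α|x|} |f(x)|`, possibly infinite. -/
def weightedNorm (α : ℝ) (f : ℝ → ℝ) : ENNReal :=
  ⨆ x : ℝ, ENNReal.ofReal (Real.exp (α * |x|) * |f x|)

/-- The space `C_α` of continuous functions with finite weighted norm. -/
def weightedSpace (α : ℝ) : Set (ℝ → ℝ) := {f | Continuous f ∧ weightedNorm α f < ⊤}

/-- The absorbing ball: the nonnegative (that is, admissible as temperatures) functions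
in `C_α` with `|f|_α ≤ V₀ / √γ + ε`. -/
def absorbingBall (γ V₀ α ε : ℝ) : Set (ℝ → ℝ) :=
  {f | f ∈ weightedSpace α ∧ (∀ x, 0 ≤ f x) ∧
    weightedNorm α f ≤ ENNReal.ofReal (V₀ / Real.sqrt γ + ε)}

/-- The attractor: the `ω`-limit set `⋂_{r ≥ 0} closure (⋃_{t ≥ r} T(t) B)` of the absorbing ball
`B`, the closure being taken in `C_α`. -/
def attractor (γ : ℝ) (g : ℝ → ℝ) (V₀ α ε : ℝ) : Set (ℝ → ℝ) :=
  {φ | φ ∈ weightedSpace α ∧ ∀ r : ℝ, 0 ≤ r → ∀ δ : ℝ, 0 < δ →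
    ∃ t : ℝ, r ≤ t ∧ ∃ u₀ ∈ absorbingBall γ V₀ α ε, ∃ ψ : ℝ → ℝ,
      Evolves γ g t u₀ ψ ∧ weightedNorm α (fun x => φ x - ψ x) < ENNReal.ofReal δ}

/-- The positive root of `α² + α V₀ - γ = 0`. -/
def alphaTime (γ V₀ : ℝ) : ℝ := V₀ / 2 * (Real.sqrt (1 + 4 * γ / V₀ ^ 2) - 1)

def alphaSpace (γ v₀ V₀ : ℝ) : ℝ := min (v₀ / 4) (γ / (2 * V₀))

def alphaMin (γ v₀ V₀ : ℝ) : ℝ := min (alphaTime γ V₀) (alphaSpace γ v₀ V₀)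

end FreeInterface

end

noncomputable section

open MeasureTheory

/-! ### The singular kernel of the two-sided mode estimate -/

namespace FreeInterface

/-! In the frame of the interface the temperature `w` satisfies `w_t = w_xx + V w_x - γ w - V δ₀` in
the sense of distributions: the jump of `w_x` becomes a point source. Its Fourier transform `y ξ t`
solves the scalar equation `y' = (-(4π²ξ² + γ) + 2πiξV) y - V`. The nonlinearity enters only through
`V = g(w(0,t))`, and `g` is Lipschitz.

Let two solutions agree at time `T`, and let `q` be the difference of their interface temperatures.
The difference `z` of the modes has source `(V₁ - V₂)(2πiξ y₂ - 1)`. By parabolic smoothing this is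
at most `C |q|` on `[τ, T]`, uniformly in `ξ`. Fix a large `k`, and put `M = max e^{kt} |q(t)|` over
`[τ, T]`. Modes decaying slower than `e^{-kt}` are integrated backwards from `z(T) = 0`, the others
forwards from `τ`. In both cases the source contributes to `e^{kt} |z|` at most a constant times `M
min(T, 1/|μ - k|)`, where `μ = 4π²ξ² + γ`, hence at most a constant times `M T^{1/4} |μ -
k|^{-3/4}`. The power 3/4 is integrable in `ξ` both at the resonance `μ = k` and at infinity. With
`k = 4π²a² + γ` the integral scales like `a^{-1/2}`.

Since `|q| ≤ ∫ |z| dξ`, for large `a` the term in `M` is absorbed and `|q(t)| ≤ 2A e^{-k(t-τ)}`,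
with `A` independent of `k`. Letting `k → ∞` gives `q = 0` (`IsFourierSolution.trace_eq_zero`). The
velocities then agree, each mode solves a linear equation that is uniquely solvable backwards, and
Fourier inversion and continuity at time 0 finish (`IsProfile.eq_of_eq`).

The Fourier transform needs integrable data. Mass is damped at rate `γ` and fed at rate at most
`V₀`, so testing with slowly varying weights bounds it after a long time independently of the
initial datum. Points of the attractor inherit this bound (`integrable_of_mem_attractor`). The
classical problem is linked to the mode equations by `IsProfile.weak_identity`. -/

lemma integrable_indicator_abs_rpow :
    Integrable (indicator (Icc (-1) 1) fun x : ℝ => |x| ^ (-(3 / 4) : ℝ)) := by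
  rw [integrable_indicator_iff measurableSet_Icc, ← intervalIntegrable_iff_integrableOn_Icc_of_le
    (by norm_num)]
  have h : IntervalIntegrable (fun x : ℝ => |x| ^ (-(3 / 4) : ℝ)) volume 0 1 := by
    refine (intervalIntegral.intervalIntegrable_rpow' (r := -(3 / 4)) (by norm_num)).congr ?_
    intro x hx
    rw [uIoc_of_le zero_le_one] at hx
    simp [abs_of_pos hx.1]
  have h' := h.comp_sub_left 0
  simp only [zero_sub, abs_neg, sub_zero] at h'
  exact h'.symm.trans h

/-- The singularities at `±1` have order `3/4 < 1`, and the function decays like `|x|^{-3/2}`. The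
majorant is two translates of the local singularity plus a tail. -/
lemma integrable_abs_sq_sub_one_rpow :
    Integrable (fun x : ℝ => |x ^ 2 - 1| ^ (-(3 / 4) : ℝ)) := by
  have hH := integrable_indicator_abs_rpow
  have h1 := (hH.comp_sub_right 1).add (hH.comp_add_right 1)
  have h2 : Integrable (fun x : ℝ => (1 + ‖x‖ ^ 2) ^ (-(3 / 2) / 2 : ℝ)) :=
    integrable_rpow_neg_one_add_norm_sq (by simp; norm_num)
  have h3 := h1.add (h2.const_mul ((1 / 3 : ℝ) ^ (-(3 / 4) : ℝ)))
  refine h3.mono' (Measurable.aestronglyMeasurable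
    ((by fun_prop : Measurable fun x : ℝ => |x ^ 2 - 1|).pow_const _)) ?_
  have hne : ∀ c : ℝ, ∀ᵐ x : ℝ, x ≠ c := fun c => by
    simp [ae_iff]
  filter_upwards [hne 1, hne (-1)] with x hx1 hx2
  rw [Real.norm_of_nonneg (by positivity)]
  have hnn : ∀ y, 0 ≤ indicator (Icc (-1) 1) (fun x : ℝ => |x| ^ (-(3 / 4) : ℝ)) y := fun y =>
    indicator_nonneg (fun _ _ => by positivity) _
  have hp : 0 ≤ (1 / 3 : ℝ) ^ (-(3 / 4) : ℝ) * (1 + ‖x‖ ^ 2) ^ (-(3 / 2) / 2 : ℝ) := by positivity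
  simp only [Pi.add_apply]
  have hfac : |x ^ 2 - 1| = |x - 1| * |x + 1| := by rw [← abs_mul]; ring_nf
  by_cases c1 : |x - 1| ≤ 1 / 2
  · rw [indicator_of_mem (a := x - 1) (by rw [mem_Icc, ← abs_le]; linarith)]
    have : |x - 1| ≤ |x ^ 2 - 1| := by
      rw [hfac]
      refine le_mul_of_one_le_right (abs_nonneg _) ?_
      rw [abs_le] at c1
      rw [abs_of_nonneg] <;> linarith
    have h0 : 0 < |x - 1| := abs_pos.2 (sub_ne_zero.2 hx1)
    have := Real.rpow_le_rpow_of_nonpos h0 this (z := -(3 / 4)) (by norm_num)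
    linarith [hnn (x + 1)]
  by_cases c2 : |x + 1| ≤ 1 / 2
  · rw [indicator_of_mem (a := x + 1) (by rw [mem_Icc, ← abs_le]; linarith)]
    have : |x + 1| ≤ |x ^ 2 - 1| := by
      rw [hfac]
      refine le_mul_of_one_le_left (abs_nonneg _) ?_
      rw [abs_le] at c2
      rw [abs_of_nonpos] <;> linarith
    have h0 : 0 < |x + 1| := abs_pos.2 (by rwa [ne_eq, ← eq_neg_iff_add_eq_zero])
    have := Real.rpow_le_rpow_of_nonpos h0 this (z := -(3 / 4)) (by norm_num)
    linarith [hnn (x - 1)]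
  -- At distance more than `1/2` from both `±1`, either `x² > 9/4` or `x² < 1/4`; the constant `1/3`
  -- serves both cases.
  · have hlow : 1 / 3 * (1 + ‖x‖ ^ 2) ≤ |x ^ 2 - 1| := by
      rw [Real.norm_eq_abs, sq_abs]
      rw [not_le, lt_abs] at c1 c2
      rw [le_abs]
      rcases c1 with c1 | c1 <;> rcases c2 with c2 | c2
      · left; nlinarith
      · linarith
      · right; nlinarith
      · left; nlinarith
    have := Real.rpow_le_rpow_of_nonpos (by positivity) hlow (z := -(3 / 4)) (by norm_num)
    rw [Real.mul_rpow (by norm_num) (by positivity)] at this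
    norm_num at this ⊢
    linarith [hnn (x - 1), hnn (x + 1)]

/-- Scaling of the resolvent kernel. -/
lemma integral_abs_sq_sub_sq_rpow {a : ℝ} (ha : 0 < a) :
    Integrable (fun x : ℝ => |x ^ 2 - a ^ 2| ^ (-(3 / 4) : ℝ)) ∧
    ∫ x : ℝ, |x ^ 2 - a ^ 2| ^ (-(3 / 4) : ℝ) =
      a ^ (-(1 / 2) : ℝ) * ∫ x : ℝ, |x ^ 2 - 1| ^ (-(3 / 4) : ℝ) := by
  have h : (fun x : ℝ => |x ^ 2 - a ^ 2| ^ (-(3 / 4) : ℝ)) =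
      fun x => a ^ (-(3 / 2) : ℝ) * |(x / a) ^ 2 - 1| ^ (-(3 / 4) : ℝ) := by
    ext x
    have : |x ^ 2 - a ^ 2| = a ^ (2 : ℝ) * |(x / a) ^ 2 - 1| := by
      rw [← abs_of_pos (Real.rpow_pos_of_pos ha 2), ← abs_mul]
      congr 1
      simp
      field_simp
    rw [this, Real.mul_rpow (by positivity) (by positivity), ← Real.rpow_mul ha.le]
    norm_num
  rw [h]
  refine ⟨(integrable_abs_sq_sub_one_rpow.comp_div ha.ne').const_mul _, ?_⟩
  rw [integral_const_mul, Measure.integral_comp_div (fun x : ℝ => |x ^ 2 - 1| ^ (-(3 / 4) : ℝ)) a,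
    abs_of_pos ha, smul_eq_mul, ← mul_assoc]
  congr 1
  nth_rewrite 2 [← Real.rpow_one a]
  rw [← Real.rpow_add ha]
  norm_num
-- Geometric mean of the two bounds with exponents 1/4 and 3/4. It replaces the singularity `1/r`,
-- not integrable at the resonance, by an integrable one.
lemma le_mul_rpow_of_le_of_le {X D T r : ℝ} (hX : 0 ≤ X) (hD : 0 ≤ D) (hT : 0 ≤ T) (hr : 0 < r)
    (h1 : X ≤ D * T) (h2 : X ≤ D / r) :
    X ≤ D * (T ^ (1 / 4 : ℝ) * r ^ (-(3 / 4) : ℝ)) := by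
  have e : ∀ Y : ℝ, 0 ≤ Y → Y = Y ^ (1 / 4 : ℝ) * Y ^ (3 / 4 : ℝ) := fun Y hY => by
    rw [← Real.rpow_add' hY (by norm_num)]; norm_num
  calc X = X ^ (1 / 4 : ℝ) * X ^ (3 / 4 : ℝ) := e X hX
    _ ≤ (D * T) ^ (1 / 4 : ℝ) * (D / r) ^ (3 / 4 : ℝ) := by gcongr
    _ = (D ^ (1 / 4 : ℝ) * D ^ (3 / 4 : ℝ)) * (T ^ (1 / 4 : ℝ) * r ^ (-(3 / 4) : ℝ)) := by
      rw [Real.mul_rpow hD hT, Real.div_rpow hD hr.le, Real.rpow_neg hr.le]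
      ring
    _ = _ := by rw [← e D hD]

/-! ### Duhamel estimates for a single mode -/

section Duhamel

variable {z f : ℝ → ℂ} {μ κ k C a b : ℝ} {V : ℝ → ℝ}

/-- The integrating factor of `z' = (-μ + i κ V) z + f`. -/
def integratingFactor (μ κ : ℝ) (V : ℝ → ℝ) (t : ℝ) : ℂ :=
  Complex.exp ((μ * t : ℝ) - (κ * ∫ s in (0 : ℝ)..t, V s : ℝ) * Complex.I)

lemma norm_integratingFactor (t : ℝ) : ‖integratingFactor μ κ V t‖ = Real.exp (μ * t) := by
  simp [integratingFactor, Complex.norm_exp]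

/-- The product of the factor and `z` has derivative factor times `f`. The transport coefficient is
imaginary, so the factor has modulus `e^{μt}` whatever `V` is. -/
lemma norm_integratingFactor_mul_sub_le (hV : Continuous V) (hab : a ≤ b)
    (hz : ∀ t ∈ Icc a b, HasDerivAt z ((-(μ : ℂ) + (κ * V t : ℝ) * Complex.I) * z t + f t) t)
    {B B' : ℝ → ℝ} (hB : ∀ t, HasDerivAt B (B' t) t)
    (hf : ∀ t ∈ Icc a b, Real.exp (μ * t) * ‖f t‖ ≤ B' t) :
    ‖integratingFactor μ κ V b * z b - integratingFactor μ κ V a * z a‖ ≤ B b - B a := by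
  have hE : ∀ t, HasDerivAt (integratingFactor μ κ V)
      (integratingFactor μ κ V t * (μ - (κ * V t : ℝ) * Complex.I)) t := by
    intro t
    have h1 : HasDerivAt (fun t : ℝ => ∫ s in (0 : ℝ)..t, V s) (V t) t :=
      intervalIntegral.integral_hasDerivAt_right (hV.intervalIntegrable _ _)
        (hV.stronglyMeasurableAtFilter _ _) hV.continuousAt
    have h2 := (h1.const_mul κ).ofReal_comp.mul_const Complex.I
    have h3 := ((hasDerivAt_id t).const_mul μ).ofReal_comp.sub h2
    exact h3.cexp.congr_deriv (by simp [integratingFactor])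
  have hG : ∀ t ∈ Icc a b, HasDerivAt
      (fun t => integratingFactor μ κ V t * z t - integratingFactor μ κ V a * z a)
      (integratingFactor μ κ V t * f t) t := by
    intro t ht
    exact (((hE t).mul (hz t ht)).sub_const _).congr_deriv (by ring)
  refine image_norm_le_of_norm_deriv_right_le_deriv_boundary
    (B := fun t => B t - B a) (fun t ht => (hG t ht).continuousAt.continuousWithinAt)
    (fun t ht => (hG t (Ico_subset_Icc_self ht)).hasDerivWithinAt) (by simp)
    (fun t => (hB t).sub_const _) (fun t ht => ?_) (right_mem_Icc.2 hab)
  rw [norm_mul, norm_integratingFactor]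
  exact hf t (Ico_subset_Icc_self ht)

lemma hasDerivAt_exp_mul_div {ρ : ℝ} (hρ : ρ ≠ 0) (C t : ℝ) :
    HasDerivAt (fun t => C * Real.exp (ρ * t) / ρ) (C * Real.exp (ρ * t)) t := by
  have := (((hasDerivAt_id t).const_mul ρ).exp.const_mul C).div_const ρ
  exact this.congr_deriv (by simp; field_simp)

/-- The damping beats the weight, so the weighted initial value does not grow, and the source is
integrated against `e^{-(μ-k)(b-t)}`, of integral at most `min(T, 1/(μ-k))`. -/
lemma exp_mul_norm_le_forward (hV : Continuous V) (hab : a ≤ b) {T : ℝ} (hT : b - a ≤ T)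
    (hz : ∀ t ∈ Icc a b, HasDerivAt z ((-(μ : ℂ) + (κ * V t : ℝ) * Complex.I) * z t + f t) t)
    (hC : 0 ≤ C) (hf : ∀ t ∈ Icc a b, Real.exp (k * t) * ‖f t‖ ≤ C) (hμ : k < μ) :
    Real.exp (k * b) * ‖z b‖ ≤ Real.exp (k * a) * ‖z a‖ +
      C * (T ^ (1 / 4 : ℝ) * (μ - k) ^ (-(3 / 4) : ℝ)) := by
  have hρ : 0 < μ - k := sub_pos.2 hμ
  have hf' : ∀ t ∈ Icc a b, Real.exp (μ * t) * ‖f t‖ ≤ C * Real.exp ((μ - k) * t) := by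
    intro t ht
    have := mul_le_mul_of_nonneg_right (hf t ht) (Real.exp_pos ((μ - k) * t)).le
    calc _ = Real.exp (k * t) * ‖f t‖ * Real.exp ((μ - k) * t) := by
          rw [mul_right_comm, ← Real.exp_add]; ring_nf
      _ ≤ _ := this
  have h1 := norm_integratingFactor_mul_sub_le hV hab hz
    (hasDerivAt_exp_mul_div hρ.ne' C) hf'
  -- Here the exponential is frozen at its largest value, at the right endpoint; this gives the
  -- bound by the length of the interval.
  have h2 := norm_integratingFactor_mul_sub_le hV hab hz
    (B := fun t => C * Real.exp ((μ - k) * b) * t) (B' := fun _ => C * Real.exp ((μ - k) * b))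
    (fun t => by simpa using! (hasDerivAt_id t).const_mul (C * Real.exp ((μ - k) * b)))
    (fun t ht => (hf' t ht).trans (by gcongr; exact ht.2))
  have h3 := le_mul_rpow_of_le_of_le (norm_nonneg _) (D := C * Real.exp ((μ - k) * b))
    (by positivity) ((sub_nonneg.2 hab).trans hT) hρ
    (h2.trans (by rw [← mul_sub]; gcongr)) (h1.trans (by
      have : 0 ≤ C * Real.exp ((μ - k) * a) / (μ - k) := by positivity
      linarith))
  have h4 := norm_le_norm_add_norm_sub' (integratingFactor μ κ V b * z b)
    (integratingFactor μ κ V a * z a)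
  rw [norm_mul, norm_mul, norm_integratingFactor, norm_integratingFactor] at h4
  have h5 := mul_le_mul_of_nonneg_right (h4.trans (add_le_add_right h3 _))
    (Real.exp_pos (-((μ - k) * b))).le
  have e1 : Real.exp (μ * b) * ‖z b‖ * Real.exp (-((μ - k) * b)) =
      Real.exp (k * b) * ‖z b‖ := by
    rw [mul_right_comm, ← Real.exp_add]; ring_nf
  have e2 : Real.exp (μ * a) * ‖z a‖ * Real.exp (-((μ - k) * b)) ≤
      Real.exp (k * a) * ‖z a‖ := by
    rw [mul_right_comm, ← Real.exp_add]
    gcongr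
    nlinarith
  have e3 : ∀ Y, C * Real.exp ((μ - k) * b) * Y * Real.exp (-((μ - k) * b)) = C * Y := by
    intro Y
    have : Real.exp ((μ - k) * b) * Real.exp (-((μ - k) * b)) = 1 := by
      rw [← Real.exp_add]; simp
    linear_combination C * Y * this
  rw [add_mul, e1, e3] at h5
  linarith

/-- Backwards from a zero at `b`, the growth at rate `μ` is dominated by the weight: the kernel is
`e^{-(k-μ)(t-a)}`. -/
lemma exp_mul_norm_le_backward (hV : Continuous V) (hab : a ≤ b) {T : ℝ} (hT : b - a ≤ T)
    (hz : ∀ t ∈ Icc a b, HasDerivAt z ((-(μ : ℂ) + (κ * V t : ℝ) * Complex.I) * z t + f t) t)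
    (hC : 0 ≤ C) (hf : ∀ t ∈ Icc a b, Real.exp (k * t) * ‖f t‖ ≤ C) (hμ : μ < k) (hb : z b = 0) :
    Real.exp (k * a) * ‖z a‖ ≤ C * (T ^ (1 / 4 : ℝ) * (k - μ) ^ (-(3 / 4) : ℝ)) := by
  have hρ : 0 < k - μ := sub_pos.2 hμ
  have hf' : ∀ t ∈ Icc a b, Real.exp (μ * t) * ‖f t‖ ≤ C * Real.exp ((μ - k) * t) := by
    intro t ht
    have := mul_le_mul_of_nonneg_right (hf t ht) (Real.exp_pos ((μ - k) * t)).le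
    calc _ = Real.exp (k * t) * ‖f t‖ * Real.exp ((μ - k) * t) := by
          rw [mul_right_comm, ← Real.exp_add]; ring_nf
      _ ≤ _ := this
  have h1 := norm_integratingFactor_mul_sub_le hV hab hz
    (hasDerivAt_exp_mul_div (by linarith : μ - k ≠ 0 ) C) hf'
  have h2 := norm_integratingFactor_mul_sub_le hV hab hz
    (B := fun t => C * Real.exp ((μ - k) * a) * t) (B' := fun _ => C * Real.exp ((μ - k) * a))
    (fun t => by simpa using! (hasDerivAt_id t).const_mul (C * Real.exp ((μ - k) * a)))
    (fun t ht => (hf' t ht).trans (by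
      gcongr C * Real.exp ?_
      nlinarith [ht.1]))
  have h3 := le_mul_rpow_of_le_of_le (norm_nonneg _) (D := C * Real.exp ((μ - k) * a))
    (by positivity) ((sub_nonneg.2 hab).trans hT) hρ
    (h2.trans (by rw [← mul_sub]; gcongr)) (h1.trans (by
      have : 0 ≤ C * Real.exp ((μ - k) * b) / (k - μ) := by positivity
      rw [← neg_sub k μ, div_neg, div_neg, neg_sub k μ]
      linarith))
  rw [hb, mul_zero, zero_sub, norm_neg, norm_mul, norm_integratingFactor] at h3
  have h5 := mul_le_mul_of_nonneg_right h3 (Real.exp_pos (-((μ - k) * a))).le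
  have e1 : Real.exp (μ * a) * ‖z a‖ * Real.exp (-((μ - k) * a)) =
      Real.exp (k * a) * ‖z a‖ := by
    rw [mul_right_comm, ← Real.exp_add]; ring_nf
  have e3 : ∀ Y, C * Real.exp ((μ - k) * a) * Y * Real.exp (-((μ - k) * a)) = C * Y := by
    intro Y
    have : Real.exp ((μ - k) * a) * Real.exp (-((μ - k) * a)) = 1 := by
      rw [← Real.exp_add]; simp
    linear_combination C * Y * this
  rwa [e1, e3] at h5

/-- Smoothing: `e^{-μ(b-a)} ≤ 1/(μ(b-a))`, so the initial value also acquires the factor `1/μ`. -/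
lemma norm_le_div_of_damped (hV : Continuous V) (hab : a < b)
    (hz : ∀ t ∈ Icc a b, HasDerivAt z ((-(μ : ℂ) + (κ * V t : ℝ) * Complex.I) * z t + f t) t)
    (hf : ∀ t ∈ Icc a b, ‖f t‖ ≤ C) (hμ : 0 < μ) :
    ‖z b‖ ≤ (‖z a‖ / (b - a) + C) / μ := by
  have hC : 0 ≤ C := (norm_nonneg _).trans (hf a (left_mem_Icc.2 hab.le))
  have h1 := norm_integratingFactor_mul_sub_le hV hab.le hz
    (hasDerivAt_exp_mul_div hμ.ne' C) (fun t ht => by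
      rw [mul_comm]
      exact mul_le_mul_of_nonneg_right (hf t ht) (Real.exp_pos _).le)
  have h4 := norm_le_norm_add_norm_sub' (integratingFactor μ κ V b * z b)
    (integratingFactor μ κ V a * z a)
  rw [norm_mul, norm_mul, norm_integratingFactor, norm_integratingFactor] at h4
  have hpos : 0 ≤ C * Real.exp (μ * a) / μ := by positivity
  have h5 : Real.exp (μ * b) * ‖z b‖ ≤ Real.exp (μ * a) * ‖z a‖ + C * Real.exp (μ * b) / μ := by
    linarith
  have h6 : Real.exp (μ * a) * (μ * (b - a)) ≤ Real.exp (μ * b) := by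
    have : μ * (b - a) ≤ Real.exp (μ * (b - a)) := by
      linarith [Real.add_one_le_exp (μ * (b - a))]
    calc _ ≤ Real.exp (μ * a) * Real.exp (μ * (b - a)) := by gcongr
      _ = _ := by rw [← Real.exp_add]; ring_nf
  have hba := sub_pos.2 hab
  have h7 : Real.exp (μ * a) * ‖z a‖ ≤ Real.exp (μ * b) * (‖z a‖ / (b - a) / μ) := by
    calc _ = Real.exp (μ * a) * (μ * (b - a)) * (‖z a‖ / (b - a) / μ) := by
          field_simp
      _ ≤ _ := by gcongr
  refine le_of_mul_le_mul_left (h5.trans ((add_le_add_left h7 _).trans (le_of_eq ?_)))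
    (Real.exp_pos (μ * b))
  ring

end Duhamel

end FreeInterface

/-! ### Backward uniqueness for the mode equations -/

namespace FreeInterface

/-- The decay rate of the Fourier mode of frequency `ξ`. -/
def modeRate (γ ξ : ℝ) : ℝ := 4 * Real.pi ^ 2 * ξ ^ 2 + γ

lemma modeRate_pos {γ : ℝ} (hγ : 0 < γ) (ξ : ℝ) : 0 < modeRate γ ξ := by
  unfold modeRate; positivity

lemma integrable_inv_modeRate {γ : ℝ} (hγ : 0 < γ) : Integrable fun ξ => (modeRate γ ξ)⁻¹ := by
  have hc : 0 < min (4 * Real.pi ^ 2) γ := by positivity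
  refine (integrable_inv_one_add_sq.const_mul (min (4 * Real.pi ^ 2) γ)⁻¹).mono'
    (Measurable.aestronglyMeasurable (by unfold modeRate; fun_prop)) (ae_of_all _ fun ξ => ?_)
  rw [Real.norm_of_nonneg (inv_nonneg.2 (modeRate_pos hγ ξ).le), ← mul_inv]
  refine inv_anti₀ (by positivity) ?_
  have h1 := min_le_left (4 * Real.pi ^ 2) γ
  have h2 := min_le_right (4 * Real.pi ^ 2) γ
  unfold modeRate
  nlinarith [sq_nonneg ξ]

/-- `y ξ t` behaves as the Fourier transform at frequency `ξ` of the temperature profile at time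
`t`, in the frame moving with velocity `V`. -/
structure IsFourierSolution (γ V₀ N : ℝ) (V : ℝ → ℝ) (y : ℝ → ℝ → ℂ) : Prop where
  continuous_velocity : Continuous V
  velocity_le : ∀ t, |V t| ≤ V₀
  hasDerivAt : ∀ ξ t, 0 < t → HasDerivAt (y ξ)
    ((-(modeRate γ ξ : ℂ) + (2 * Real.pi * ξ * V t : ℝ) * Complex.I) * y ξ t + (-(V t : ℂ))) t
  norm_le : ∀ ξ t, 0 < t → ‖y ξ t‖ ≤ N
  continuous : ∀ t, 0 < t → Continuous fun ξ => y ξ t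

namespace IsFourierSolution

variable {γ V₀ N : ℝ} {V V₁ V₂ : ℝ → ℝ} {y y₁ y₂ : ℝ → ℝ → ℂ}

/-- The smoothing estimate on `[t/2, t]`. The resulting decay `ξ⁻²` makes the modes integrable at
positive times. -/
lemma norm_le_div (hy : IsFourierSolution γ V₀ N V y) (hγ : 0 < γ) (ξ : ℝ) {t : ℝ} (ht : 0 < t) :
    ‖y ξ t‖ ≤ (2 * N / t + V₀) / modeRate γ ξ := by
  have h := norm_le_div_of_damped (z := y ξ) (μ := modeRate γ ξ) (κ := 2 * Real.pi * ξ) (C := V₀)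
    hy.continuous_velocity (a := t / 2) (b := t) (by linarith)
    (fun s hs => hy.hasDerivAt ξ s (by linarith [hs.1])) (fun s _ => by simpa using hy.velocity_le s)
    (modeRate_pos hγ ξ)
  refine h.trans ?_
  refine div_le_div_of_nonneg_right (add_le_add_left ?_ _) (modeRate_pos hγ ξ).le
  have hhalf : t - t / 2 = t / 2 := by ring
  rw [hhalf]
  calc ‖y ξ (t / 2)‖ / (t / 2) ≤ N / (t / 2) :=
        div_le_div_of_nonneg_right (hy.norm_le ξ _ (by linarith)) (by linarith)
    _ = _ := by field_simp

lemma integrable (hy : IsFourierSolution γ V₀ N V y) (hγ : 0 < γ) {t : ℝ} (ht : 0 < t) :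
    Integrable fun ξ => y ξ t :=
  ((integrable_inv_modeRate hγ).const_mul (2 * N / t + V₀)).mono'
    (hy.continuous t ht).aestronglyMeasurable (ae_of_all _ fun ξ => by
      simpa [div_eq_mul_inv] using hy.norm_le_div hγ ξ ht)

/-- From `2√γ |η| ≤ η² + γ`. It bounds, uniformly in frequency, the source created by the difference
of the transport terms. -/
lemma abs_mul_norm_le (hy : IsFourierSolution γ V₀ N V y) (hγ : 0 < γ) (ξ : ℝ) {t : ℝ}
    (ht : 0 < t) : |2 * Real.pi * ξ| * ‖y ξ t‖ ≤ (2 * N / t + V₀) / (2 * √γ) := by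
  have h := hy.norm_le_div hγ ξ ht
  have hm := modeRate_pos hγ ξ
  have hs : 0 < √γ := Real.sqrt_pos.2 hγ
  have hA : 0 ≤ 2 * N / t + V₀ := by
    have h0 := (norm_nonneg _).trans (hy.norm_le ξ t ht)
    have h1 := (abs_nonneg _).trans (hy.velocity_le 0)
    positivity
  calc |2 * Real.pi * ξ| * ‖y ξ t‖
      ≤ |2 * Real.pi * ξ| * ((2 * N / t + V₀) / modeRate γ ξ) := by gcongr
    _ = (2 * N / t + V₀) * (|2 * Real.pi * ξ| / modeRate γ ξ) := by ring
    _ ≤ (2 * N / t + V₀) * (1 / (2 * √γ)) := by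
      refine mul_le_mul_of_nonneg_left ?_ hA
      rw [div_le_div_iff₀ hm (by positivity)]
      have h1 : modeRate γ ξ = |2 * Real.pi * ξ| ^ 2 + √γ ^ 2 := by
        rw [Real.sq_sqrt hγ.le, sq_abs, modeRate]; ring
      rw [h1]
      nlinarith [sq_nonneg (|2 * Real.pi * ξ| - √γ)]
    _ = _ := by ring

lemma hasDerivAt_sub (h₁ : IsFourierSolution γ V₀ N V₁ y₁) (h₂ : IsFourierSolution γ V₀ N V₂ y₂)
    (ξ : ℝ) {t : ℝ} (ht : 0 < t) : HasDerivAt (fun t => y₁ ξ t - y₂ ξ t)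
      ((-(modeRate γ ξ : ℂ) + (2 * Real.pi * ξ * V₁ t : ℝ) * Complex.I) * (y₁ ξ t - y₂ ξ t) +
        ((V₁ t - V₂ t : ℝ) : ℂ) * ((2 * Real.pi * ξ : ℝ) * Complex.I * y₂ ξ t - 1)) t := by
  refine ((h₁.hasDerivAt ξ t ht).sub (h₂.hasDerivAt ξ t ht)).congr_deriv ?_
  push_cast
  ring

/-- Weighted estimate for the difference of two solutions that coincide at time `T`: low modes are
integrated backwards from `T`, high modes forwards from `τ`. -/
lemma exp_mul_norm_sub_le (h₁ : IsFourierSolution γ V₀ N V₁ y₁)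
    (h₂ : IsFourierSolution γ V₀ N V₂ y₂) (hγ : 0 < γ) {k M τ T t ξ : ℝ} (hτ : 0 < τ)
    (ht : t ∈ Icc τ T) (hT : y₁ ξ T = y₂ ξ T)
    (hM : ∀ s ∈ Icc τ T, Real.exp (k * s) * |V₁ s - V₂ s| ≤ M) (hk : modeRate γ ξ ≠ k) :
    Real.exp (k * t) * ‖y₁ ξ t - y₂ ξ t‖ ≤ Real.exp (k * τ) * ‖y₁ ξ τ - y₂ ξ τ‖ +
      M * ((2 * N / τ + V₀) / (2 * √γ) + 1) *
        (T ^ (1 / 4 : ℝ) * |modeRate γ ξ - k| ^ (-(3 / 4) : ℝ)) := by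
  have hN := (norm_nonneg _).trans (h₁.norm_le 0 τ hτ)
  have hV := (abs_nonneg _).trans (h₁.velocity_le 0)
  have hM0 : 0 ≤ M := (mul_nonneg (Real.exp_pos _).le (abs_nonneg _)).trans (hM t ht)
  have hs : 0 < √γ := Real.sqrt_pos.2 hγ
  have hC : 0 ≤ M * ((2 * N / τ + V₀) / (2 * √γ) + 1) := by positivity
  have hf : ∀ s ∈ Icc τ T, Real.exp (k * s) * ‖((V₁ s - V₂ s : ℝ) : ℂ) *
      ((2 * Real.pi * ξ : ℝ) * Complex.I * y₂ ξ s - 1)‖ ≤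
        M * ((2 * N / τ + V₀) / (2 * √γ) + 1) := by
    intro s hs'
    have hs0 : 0 < s := hτ.trans_le hs'.1
    rw [norm_mul, ← mul_assoc, Complex.norm_real, Real.norm_eq_abs]
    refine mul_le_mul (hM s hs') ?_ (norm_nonneg _) hM0
    refine (norm_sub_le _ _).trans ?_
    rw [norm_one, norm_mul, norm_mul, Complex.norm_real, Complex.norm_I, mul_one, Real.norm_eq_abs]
    refine add_le_add_left ((h₂.abs_mul_norm_le hγ ξ hs0).trans ?_) _
    gcongr
    exact hs'.1
  have hz : ∀ s ∈ Icc τ T, _ := fun s hs' => hasDerivAt_sub h₁ h₂ ξ (hτ.trans_le hs'.1)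
  rcases lt_or_gt_of_ne hk with hlt | hgt
  · have := exp_mul_norm_le_backward h₁.continuous_velocity ht.2 (T := T)
      (by linarith [ht.1]) (fun s hs' => hz s ⟨ht.1.trans hs'.1, hs'.2⟩) hC
      (fun s hs' => hf s ⟨ht.1.trans hs'.1, hs'.2⟩) hlt (by simp [hT])
    rw [abs_sub_comm, abs_of_pos (sub_pos.2 hlt)]
    have h0 : 0 ≤ Real.exp (k * τ) * ‖y₁ ξ τ - y₂ ξ τ‖ := by positivity
    linarith
  · have := exp_mul_norm_le_forward h₁.continuous_velocity ht.1 (T := T)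
      (by linarith [ht.2]) (fun s hs' => hz s ⟨hs'.1, hs'.2.trans ht.2⟩) hC
      (fun s hs' => hf s ⟨hs'.1, hs'.2.trans ht.2⟩) hgt
    rwa [abs_of_pos (sub_pos.2 hgt)]

/-- If two solutions coincide at time `T` and the difference of the velocities is controlled by the
difference of the interface temperatures, then the latter vanishes before `T`. -/
theorem trace_eq_zero (h₁ : IsFourierSolution γ V₀ N V₁ y₁) (h₂ : IsFourierSolution γ V₀ N V₂ y₂)
    (hγ : 0 < γ) {L T : ℝ} {q : ℝ → ℝ} (hq : Continuous q)
    (hL : ∀ t, 0 < t → |V₁ t - V₂ t| ≤ L * |q t|)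
    (hqy : ∀ t, 0 < t → |q t| ≤ ∫ ξ, ‖y₁ ξ t - y₂ ξ t‖) (hT : ∀ ξ, y₁ ξ T = y₂ ξ T)
    {t : ℝ} (ht : t ∈ Ioc 0 T) : q t = 0 := by
  -- The source bound degenerates like `1/τ` at time zero, and the final exponential gain needs `τ <
  -- t`.
  obtain ⟨τ, hτ, hτt⟩ := exists_between ht.1
  have hL' : ∀ t, 0 < t → |V₁ t - V₂ t| ≤ |L| * |q t| := fun t ht =>
    (hL t ht).trans (by gcongr; exact le_abs_self L)
  have hτT : τ ≤ T := hτt.le.trans ht.2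
  set J : ℝ := ∫ x : ℝ, |x ^ 2 - 1| ^ (-(3 / 4) : ℝ) with hJ
  set C₀ : ℝ := (2 * N / τ + V₀) / (2 * √γ) + 1 with hC₀
  set A : ℝ := ∫ ξ, ‖y₁ ξ τ - y₂ ξ τ‖ with hA
  set c : ℝ := T ^ (1 / 4 : ℝ) * (4 * Real.pi ^ 2) ^ (-(3 / 4) : ℝ) with hc
  -- The exponent `k` is the rate of the modes `ξ = ±a`. The assumed smallness is that of the
  -- coefficient of `M` after integration over all frequencies.
  have hkey : ∀ a : ℝ, 0 < a → |L| * C₀ * c * (a ^ (-(1 / 2) : ℝ) * J) ≤ 1 / 2 →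
      |q t| ≤ 2 * A * Real.exp (-((4 * Real.pi ^ 2 * a ^ 2 + γ) * (t - τ))) := by
    intro a ha hsmall
    set k := 4 * Real.pi ^ 2 * a ^ 2 + γ with hk
    obtain ⟨s, hs, hmax⟩ := isCompact_Icc.exists_isMaxOn (nonempty_Icc.2 hτT)
      (f := fun s => Real.exp (k * s) * |q s|) (by fun_prop)
    set M := Real.exp (k * s) * |q s| with hM
    have hM' : ∀ r ∈ Icc τ T, Real.exp (k * r) * |q r| ≤ M := fun r hr => hmax hr
    have hMV : ∀ r ∈ Icc τ T, Real.exp (k * r) * |V₁ r - V₂ r| ≤ |L| * M := fun r hr =>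
      calc _ ≤ Real.exp (k * r) * (|L| * |q r|) := by
            gcongr; exact hL' r (hτ.trans_le hr.1)
        _ = |L| * (Real.exp (k * r) * |q r|) := by ring
        _ ≤ _ := by gcongr; exact hM' r hr
    have hs0 : 0 < s := hτ.trans_le hs.1
    obtain ⟨hi, hie⟩ := integral_abs_sq_sub_sq_rpow ha
    have hrate : ∀ ξ, |modeRate γ ξ - k| ^ (-(3 / 4) : ℝ) =
        (4 * Real.pi ^ 2) ^ (-(3 / 4) : ℝ) * |ξ ^ 2 - a ^ 2| ^ (-(3 / 4) : ℝ) := by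
      intro ξ
      rw [← Real.mul_rpow (by positivity) (abs_nonneg _)]
      congr 1
      rw [← abs_of_pos (by positivity : 0 < 4 * Real.pi ^ 2), ← abs_mul, modeRate, hk]
      congr 1
      ring
    have hd : ∀ r, 0 < r → Integrable fun ξ => ‖y₁ ξ r - y₂ ξ r‖ := fun r hr =>
      ((h₁.integrable hγ hr).sub (h₂.integrable hγ hr)).norm
    have hne : ∀ b : ℝ, ∀ᵐ x : ℝ, x ≠ b := fun b => by simp [ae_iff]
    have hMle : M ≤ Real.exp (k * τ) * A + |L| * M * C₀ * (c * (a ^ (-(1 / 2) : ℝ) * J)) := by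
      calc M ≤ Real.exp (k * s) * ∫ ξ, ‖y₁ ξ s - y₂ ξ s‖ := by
            rw [hM]; gcongr; exact hqy s hs0
        _ = ∫ ξ, Real.exp (k * s) * ‖y₁ ξ s - y₂ ξ s‖ := (integral_const_mul _ _).symm
        _ ≤ ∫ ξ, (Real.exp (k * τ) * ‖y₁ ξ τ - y₂ ξ τ‖ +
              |L| * M * C₀ * (c * |ξ ^ 2 - a ^ 2| ^ (-(3 / 4) : ℝ))) := by
            refine integral_mono_ae ((hd s hs0).const_mul _)
              (((hd τ hτ).const_mul _).add ((hi.const_mul _).const_mul _)) ?_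
            filter_upwards [hne a, hne (-a)] with ξ hξ1 hξ2
            have hk' : modeRate γ ξ ≠ k := by
              rw [modeRate, hk]
              intro h
              have h3 : (ξ - a) * (ξ + a) = 0 := by
                have : 4 * Real.pi ^ 2 * ((ξ - a) * (ξ + a)) = 0 := by linear_combination h
                exact (mul_eq_zero.1 this).resolve_left (by positivity)
              rcases mul_eq_zero.1 h3 with h4 | h4
              · exact hξ1 (by linarith)
              · exact hξ2 (by linarith)
            have := exp_mul_norm_sub_le h₁ h₂ hγ hτ hs (hT ξ) hMV hk'
            rwa [hrate, ← mul_assoc (T ^ (1 / 4 : ℝ))] at this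
        _ = _ := by
            rw [integral_add ((hd τ hτ).const_mul _) ((hi.const_mul _).const_mul _),
              integral_const_mul, integral_const_mul, integral_const_mul, hie]
    have hM0 : 0 ≤ M := by positivity
    -- At most half of `M` stands on the right of `hMle`, and it is absorbed.
    have hM2 : M ≤ 2 * A * Real.exp (k * τ) := by nlinarith
    have h3 := (hM' t ⟨hτt.le, ht.2⟩).trans hM2
    have h4 := mul_le_mul_of_nonneg_right h3 (Real.exp_pos (-(k * t))).le
    rw [mul_right_comm, ← Real.exp_add, mul_assoc (2 * A), ← Real.exp_add] at h4
    have e1 : k * t + -(k * t) = 0 := by ring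
    have e2 : k * τ + -(k * t) = -(k * (t - τ)) := by ring
    rwa [e1, e2, Real.exp_zero, one_mul] at h4
  have hlim1 : Tendsto (fun a : ℝ => |L| * C₀ * c * (a ^ (-(1 / 2) : ℝ) * J)) atTop (𝓝 0) := by
    have := ((tendsto_rpow_neg_atTop (y := 1 / 2) (by norm_num)).mul_const J).const_mul
      (|L| * C₀ * c)
    simpa using this
  have hlim2 : Tendsto (fun a : ℝ =>
      2 * A * Real.exp (-((4 * Real.pi ^ 2 * a ^ 2 + γ) * (t - τ)))) atTop (𝓝 0) := by
    have h1 : Tendsto (fun a : ℝ => (4 * Real.pi ^ 2 * a ^ 2 + γ) * (t - τ)) atTop atTop := by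
      refine Tendsto.atTop_mul_const (sub_pos.2 hτt) (tendsto_atTop_add_const_right _ _ ?_)
      exact Tendsto.const_mul_atTop (by positivity) (tendsto_pow_atTop two_ne_zero)
    simpa using (Real.tendsto_exp_neg_atTop_nhds_zero.comp h1).const_mul (2 * A)
  have : |q t| ≤ 0 := by
    refine ge_of_tendsto hlim2 ?_
    filter_upwards [eventually_gt_atTop 0,
      hlim1.eventually (eventually_le_nhds (by norm_num : (0 : ℝ) < 1 / 2))] with a ha hs
    exact hkey a ha hs
  exact abs_eq_zero.1 (le_antisymm this (abs_nonneg _))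

/-- With equal velocities the source vanishes, so the backward estimate applies with `C = 0` and any
`k` above the rate. -/
theorem eq_of_eq (h₁ : IsFourierSolution γ V₀ N V₁ y₁) (h₂ : IsFourierSolution γ V₀ N V₂ y₂)
    {T : ℝ} (hV : ∀ t ∈ Ioc 0 T, V₁ t = V₂ t) (hT : ∀ ξ, y₁ ξ T = y₂ ξ T)
    {t : ℝ} (ht : t ∈ Ioc 0 T) (ξ : ℝ) : y₁ ξ t = y₂ ξ t := by
  obtain ⟨k, hk⟩ := exists_gt (modeRate γ ξ)
  have hz : ∀ s ∈ Icc t T, _ := fun s hs => hasDerivAt_sub h₁ h₂ ξ (ht.1.trans_le hs.1)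
  have := exp_mul_norm_le_backward (C := 0) h₁.continuous_velocity ht.2 le_rfl hz le_rfl
    (fun s hs => by simp [hV s ⟨ht.1.trans_le hs.1, hs.2⟩]) hk (by simp [hT])
  rw [zero_mul] at this
  have h0 := nonpos_of_mul_nonpos_right this (Real.exp_pos _)
  exact sub_eq_zero.1 (norm_le_zero_iff.1 h0)

end IsFourierSolution

end FreeInterface

/-! ### Profiles in the moving frame and Green's identity -/

namespace FreeInterface

/-- A nonnegative bounded temperature `w` in the frame attached to the interface `x = 0`, which
moves with velocity `V`; here `p = w_x` and `r = w_xx`. -/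
structure IsProfile (γ V₀ : ℝ) (w p r : ℝ → ℝ → ℝ) (V : ℝ → ℝ) : Prop where
  continuous : Continuous (Function.uncurry w)
  continuous_velocity : Continuous V
  velocity_le : ∀ t, |V t| ≤ V₀
  nonneg : ∀ x t, 0 ≤ w x t
  bounded : ∃ M, ∀ x t, w x t ≤ M
  hasDerivAt_x : ∀ x t, 0 < t → x ≠ 0 → HasDerivAt (fun y => w y t) (p x t) x
  hasDerivAt_xx : ∀ x t, 0 < t → x ≠ 0 → HasDerivAt (fun y => p y t) (r x t) x
  hasDerivAt_t : ∀ x t, 0 < t → x ≠ 0 →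
    HasDerivAt (fun s => w x s) (r x t + V t * p x t - γ * w x t) t
  continuousOn_p : ContinuousOn (Function.uncurry p) {z | z.1 ≠ 0 ∧ 0 < z.2}
  continuousOn_r : ContinuousOn (Function.uncurry r) {z | z.1 ≠ 0 ∧ 0 < z.2}
  jump : ∀ t, 0 < t → ∃ left right : ℝ,
    Tendsto (Function.uncurry p) (𝓝[{z | z.1 < 0}] (0, t)) (𝓝 left) ∧
    Tendsto (Function.uncurry p) (𝓝[{z | 0 < z.1}] (0, t)) (𝓝 right) ∧
    right - left = V t

variable {E : Type*} [NormedAddCommGroup E] [NormedSpace ℝ E]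

/-- A twice continuously differentiable function, with its derivatives. -/
structure IsTest (φ φ₁ φ₂ : ℝ → E) : Prop where
  deriv : ∀ x, HasDerivAt φ (φ₁ x) x
  deriv₂ : ∀ x, HasDerivAt φ₁ (φ₂ x) x
  continuous₂ : Continuous φ₂

namespace IsTest

variable {φ φ₁ φ₂ : ℝ → E}

lemma continuous (h : IsTest φ φ₁ φ₂) : Continuous φ :=
  continuous_iff_continuousAt.2 fun x => (h.deriv x).continuousAt

lemma continuous₁ (h : IsTest φ φ₁ φ₂) : Continuous φ₁ :=
  continuous_iff_continuousAt.2 fun x => (h.deriv₂ x).continuousAt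

end IsTest

/-- The adjoint operator `φ ↦ φ'' - c φ' - γ φ`. -/
def adjointOp (γ c : ℝ) (φ φ₁ φ₂ : ℝ → E) (x : ℝ) : E := φ₂ x - c • φ₁ x - γ • φ x

namespace IsProfile

variable {γ V₀ : ℝ} {w p r : ℝ → ℝ → ℝ} {V : ℝ → ℝ} {φ φ₁ φ₂ : ℝ → E}

lemma continuous_slice (h : IsProfile γ V₀ w p r V) (t : ℝ) : Continuous fun x => w x t :=
  h.continuous.comp₂ continuous_id continuous_const

lemma continuous_time (h : IsProfile γ V₀ w p r V) (x : ℝ) : Continuous fun t => w x t :=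
  h.continuous.comp₂ continuous_const continuous_id

lemma bound_nonneg (h : IsProfile γ V₀ w p r V) : 0 ≤ V₀ :=
  (abs_nonneg _).trans (h.velocity_le 0)

/-- The flux through a fixed point, tested with `φ`. -/
def flux (w p : ℝ → ℝ → ℝ) (V : ℝ → ℝ) (φ φ₁ : ℝ → E) (x t : ℝ) : E :=
  p x t • φ x - w x t • φ₁ x + (V t * w x t) • φ x

lemma continuous_adjoint_integral (h : IsProfile γ V₀ w p r V) (hφ : IsTest φ φ₁ φ₂) (c d : ℝ) :
    Continuous fun t => ∫ x in c..d, w x t • adjointOp γ (V t) φ φ₁ φ₂ x := by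
  have h1 := hφ.continuous
  have h2 := hφ.continuous₁
  have h3 := hφ.continuous₂
  have h4 := h.continuous_velocity
  have h5 : Continuous fun q : ℝ × ℝ => w q.2 q.1 := h.continuous.comp continuous_swap
  refine intervalIntegral.continuous_parametric_intervalIntegral_of_continuous' ?_ c d
  unfold adjointOp
  exact h5.smul (by fun_prop)

lemma continuousOn_flux (h : IsProfile γ V₀ w p r V) {x : ℝ} (hx : x ≠ 0) :
    ContinuousOn (fun t => flux w p V φ φ₁ x t) (Ioi 0) := by
  have h1 : ContinuousOn (fun t => p x t) (Ioi 0) :=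
    h.continuousOn_p.comp (f := fun t => (x, t)) (by fun_prop) (fun t ht => ⟨hx, ht⟩)
  have h2 := h.continuous_time x
  have h3 := h.continuous_velocity
  unfold flux
  fun_prop

/-- The gradient is bounded near the interface, locally uniformly in positive times. -/
lemma exists_bound_gradient (h : IsProfile γ V₀ w p r V) {a b : ℝ} (ha : 0 < a) :
    ∃ η > 0, ∃ K, ∀ x, x ≠ 0 → |x| < η → ∀ t ∈ Icc a b, |p x t| ≤ K := by
  refine isCompact_Icc.induction_on
    (p := fun S => ∃ η > 0, ∃ K, ∀ x, x ≠ 0 → |x| < η → ∀ t ∈ S, |p x t| ≤ K) ?_ ?_ ?_ ?_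
  · exact ⟨1, one_pos, 0, by simp⟩
  · rintro s t hst ⟨η, hη, K, hK⟩
    exact ⟨η, hη, K, fun x hx hx' τ hτ => hK x hx hx' τ (hst hτ)⟩
  · rintro s t ⟨η, hη, K, hK⟩ ⟨η', hη', K', hK'⟩
    refine ⟨min η η', lt_min hη hη', max K K', fun x hx hx' τ hτ => ?_⟩
    rcases hτ with hτ | hτ
    · exact (hK x hx (hx'.trans_le (min_le_left _ _)) τ hτ).trans (le_max_left _ _)
    · exact (hK' x hx (hx'.trans_le (min_le_right _ _)) τ hτ).trans (le_max_right _ _)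
  · intro t ht
    obtain ⟨l, l', hl, hl', -⟩ := h.jump t (ha.trans_le ht.1)
    have e1 := hl.abs.eventually (eventually_le_nhds (lt_add_one |l|))
    have e2 := hl'.abs.eventually (eventually_le_nhds (lt_add_one |l'|))
    rw [eventually_nhdsWithin_iff] at e1 e2
    obtain ⟨δ, hδ, hball⟩ := Metric.eventually_nhds_iff_ball.1 (e1.and e2)
    refine ⟨Metric.ball t δ, mem_nhdsWithin_of_mem_nhds (Metric.ball_mem_nhds t hδ), δ, hδ,
      max (|l| + 1) (|l'| + 1), fun x hx hx' τ hτ => ?_⟩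
    have hmem : (x, τ) ∈ Metric.ball ((0 : ℝ), t) δ := by
      rw [← ball_prod_same]
      exact ⟨by simpa using hx', hτ⟩
    obtain ⟨b1, b2⟩ := hball _ hmem
    rcases lt_or_gt_of_ne hx with hneg | hpos
    · exact (b1 hneg).trans (le_max_left _ _)
    · exact (b2 hpos).trans (le_max_right _ _)

/-- Since `w`, `φ` and `φ₁` are continuous, only the jump of `p` survives. This is the origin of the
source `-V δ₀`. -/
lemma tendsto_flux_sub_flux (h : IsProfile γ V₀ w p r V) (hφ : IsTest φ φ₁ φ₂) {t : ℝ}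
    (ht : 0 < t) : Tendsto (fun η => flux w p V φ φ₁ (-η) t - flux w p V φ φ₁ η t) (𝓝[>] 0)
      (𝓝 (-(V t • φ 0))) := by
  obtain ⟨l, l', hl, hl', hj⟩ := h.jump t ht
  have c1 : Tendsto (fun η : ℝ => -η) (𝓝[>] 0) (𝓝 0) := by
    have : Tendsto (fun η : ℝ => -η) (𝓝 0) (𝓝 0) := by simpa using (continuous_neg (G := ℝ)).tendsto 0
    exact this.mono_left nhdsWithin_le_nhds
  have c2 : Tendsto (fun η : ℝ => η) (𝓝[>] 0) (𝓝 0) := nhdsWithin_le_nhds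
  have t1 : Tendsto (fun η : ℝ => p (-η) t) (𝓝[>] 0) (𝓝 l) := by
    refine hl.comp (f := fun η : ℝ => (-η, t)) (tendsto_nhdsWithin_iff.2
      ⟨c1.prodMk_nhds tendsto_const_nhds, ?_⟩)
    filter_upwards [self_mem_nhdsWithin] with η hη
    simpa using hη
  have t2 : Tendsto (fun η : ℝ => p η t) (𝓝[>] 0) (𝓝 l') := by
    refine hl'.comp (f := fun η : ℝ => (η, t)) (tendsto_nhdsWithin_iff.2
      ⟨c2.prodMk_nhds tendsto_const_nhds, ?_⟩)
    filter_upwards [self_mem_nhdsWithin] with η hη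
    simpa using hη
  have k1 := (hφ.continuous.tendsto 0)
  have k2 := (hφ.continuous₁.tendsto 0)
  have k3 := ((h.continuous_slice t).tendsto 0)
  have f1 := ((t1.smul (k1.comp c1)).sub ((k3.comp c1).smul (k2.comp c1))).add
    (((k3.comp c1).const_mul (V t)).smul (k1.comp c1))
  have f2 := ((t2.smul (k1.comp c2)).sub ((k3.comp c2).smul (k2.comp c2))).add
    (((k3.comp c2).const_mul (V t)).smul (k1.comp c2))
  have e : l • φ 0 - w 0 t • φ₁ 0 + (V t * w 0 t) • φ 0 -
      (l' • φ 0 - w 0 t • φ₁ 0 + (V t * w 0 t) • φ 0) = -(V t • φ 0) := by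
    rw [← hj]
    module
  rw [← e]
  exact f1.sub f2

variable [CompleteSpace E]

/-- Green's identity on a rectangle away from the interface. -/
lemma rectangle_identity (h : IsProfile γ V₀ w p r V) (hφ : IsTest φ φ₁ φ₂) {a b c d : ℝ}
    (ha : 0 < a) (hab : a ≤ b) (hcd : c ≤ d) (h0 : (0 : ℝ) ∉ Icc c d) :
    ∫ x in c..d, (w x b - w x a) • φ x =
      ∫ t in a..b, (flux w p V φ φ₁ d t - flux w p V φ φ₁ c t +
        ∫ x in c..d, w x t • adjointOp γ (V t) φ φ₁ φ₂ x) := by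
  have h1 := hφ.continuous
  have h2 := hφ.continuous₁
  have h3 := hφ.continuous₂
  have h4 := h.continuous_velocity
  have h5 := h.continuous
  have hne : ∀ x ∈ Icc c d, x ≠ 0 := fun x hx hx0 => h0 (hx0 ▸ hx)
  have hpos : ∀ t ∈ Icc a b, 0 < t := fun t ht => ha.trans_le ht.1
  have hsub : Icc c d ×ˢ Icc a b ⊆ {z : ℝ × ℝ | z.1 ≠ 0 ∧ 0 < z.2} := fun z hz =>
    ⟨hne _ hz.1, hpos _ hz.2⟩
  have hp : ContinuousOn (fun z : ℝ × ℝ => p z.1 z.2) (Icc c d ×ˢ Icc a b) :=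
    h.continuousOn_p.mono hsub
  have hr : ContinuousOn (fun z : ℝ × ℝ => r z.1 z.2) (Icc c d ×ˢ Icc a b) :=
    h.continuousOn_r.mono hsub
  have hw : Continuous (fun z : ℝ × ℝ => w z.1 z.2) := h.continuous
  have hwt : ContinuousOn (fun z : ℝ × ℝ => r z.1 z.2 + V z.2 * p z.1 z.2 - γ * w z.1 z.2)
      (Icc c d ×ˢ Icc a b) := by fun_prop
  have hwt1 : ∀ x ∈ Icc c d, ContinuousOn (fun t => r x t + V t * p x t - γ * w x t)
      (Icc a b) := fun x hx =>
    hwt.comp (f := fun t => (x, t)) (by fun_prop) (fun t ht => ⟨hx, ht⟩)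
  have hwt2 : ∀ t ∈ Icc a b, ContinuousOn (fun x => r x t + V t * p x t - γ * w x t)
      (Icc c d) := fun t ht =>
    hwt.comp (f := fun x => (x, t)) (by fun_prop) (fun x hx => ⟨hx, ht⟩)
  have step1 : ∫ x in c..d, (w x b - w x a) • φ x =
      ∫ x in c..d, ∫ t in a..b, (r x t + V t * p x t - γ * w x t) • φ x := by
    refine intervalIntegral.integral_congr fun x hx => ?_
    rw [uIcc_of_le hcd] at hx
    rw [intervalIntegral.integral_smul_const]
    congr 1
    refine (intervalIntegral.integral_eq_sub_of_hasDerivAt (fun t ht => ?_) ?_).symm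
    · rw [uIcc_of_le hab] at ht
      exact h.hasDerivAt_t x t (hpos t ht) (hne x hx)
    · refine ContinuousOn.intervalIntegrable ?_
      rw [uIcc_of_le hab]
      exact hwt1 x hx
  have step2 : ∫ x in c..d, ∫ t in a..b, (r x t + V t * p x t - γ * w x t) • φ x =
      ∫ t in a..b, ∫ x in c..d, (r x t + V t * p x t - γ * w x t) • φ x := by
    refine intervalIntegral_intervalIntegral_swap ?_
    rw [uIoc_of_le hcd, uIoc_of_le hab]
    refine IntegrableOn.mono_set ?_ (prod_mono Ioc_subset_Icc_self Ioc_subset_Icc_self)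
    refine ContinuousOn.integrableOn_compact (isCompact_Icc.prod isCompact_Icc) ?_
    simp only [Function.uncurry_def]
    fun_prop
  rw [step1, step2]
  refine intervalIntegral.integral_congr fun t ht => ?_
  rw [uIcc_of_le hab] at ht
  have ht0 := hpos t ht
  have hws := h.continuous_slice t
  have hFTC : ∫ x in c..d, ((r x t + V t * p x t - γ * w x t) • φ x -
      w x t • adjointOp γ (V t) φ φ₁ φ₂ x) = flux w p V φ φ₁ d t - flux w p V φ φ₁ c t := by
    refine intervalIntegral.integral_eq_sub_of_hasDerivAt
      (f := fun x => flux w p V φ φ₁ x t) (fun x hx => ?_) ?_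
    · rw [uIcc_of_le hcd] at hx
      have d1 := h.hasDerivAt_x x t ht0 (hne x hx)
      have d2 := h.hasDerivAt_xx x t ht0 (hne x hx)
      have := ((d2.smul (hφ.deriv x)).sub (d1.smul (hφ.deriv₂ x))).add
        ((d1.const_mul (V t)).smul (hφ.deriv x))
      refine this.congr_deriv ?_
      unfold adjointOp
      module
    · refine ContinuousOn.intervalIntegrable ?_
      rw [uIcc_of_le hcd]
      have := hwt2 t ht
      unfold adjointOp
      fun_prop
  rw [← hFTC, ← intervalIntegral.integral_add]
  · refine intervalIntegral.integral_congr fun x _ => ?_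
    simp
  · refine ContinuousOn.intervalIntegrable ?_
    rw [uIcc_of_le hcd]
    have := hwt2 t ht
    unfold adjointOp
    fun_prop
  · refine Continuous.intervalIntegrable ?_ _ _
    unfold adjointOp
    fun_prop

end IsProfile

end FreeInterface

/-! ### The weak formulation across the interface -/

namespace FreeInterface

variable {E : Type*} [NormedAddCommGroup E] [NormedSpace ℝ E]
namespace IsProfile

variable {γ V₀ : ℝ} {w p r : ℝ → ℝ → ℝ} {V : ℝ → ℝ} {φ φ₁ φ₂ : ℝ → E}

lemma norm_smul_adjointOp_le (h : IsProfile γ V₀ w p r V) {M B : ℝ} {x t : ℝ}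
    (hM : w x t ≤ M) (hB : ‖φ x‖ ≤ B) (hB₁ : ‖φ₁ x‖ ≤ B) (hB₂ : ‖φ₂ x‖ ≤ B) :
    ‖w x t • adjointOp γ (V t) φ φ₁ φ₂ x‖ ≤ M * ((1 + V₀ + |γ|) * B) := by
  have hV := h.velocity_le t
  have hV₀ := h.bound_nonneg
  have hB0 := (norm_nonneg _).trans hB
  rw [norm_smul, Real.norm_of_nonneg (h.nonneg x t)]
  refine mul_le_mul hM ?_ (norm_nonneg _) ((h.nonneg x t).trans hM)
  calc ‖adjointOp γ (V t) φ φ₁ φ₂ x‖ ≤ ‖φ₂ x‖ + ‖V t • φ₁ x‖ + ‖γ • φ x‖ :=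
        (norm_sub_le _ _).trans (add_le_add_left (norm_sub_le _ _) _)
    _ ≤ B + V₀ * B + |γ| * B := by
        rw [norm_smul, norm_smul, Real.norm_eq_abs, Real.norm_eq_abs]
        gcongr
    _ = _ := by ring

variable [CompleteSpace E]

/-- Green's identity on both sides of the excised strip `|x| < η`, with `η → 0`. The outer fluxes
vanish, and the gradient bound near the interface, available for times in `[a, b]` with `a > 0`,
provides the domination. -/
lemma weak_identity_interval (h : IsProfile γ V₀ w p r V) (hφ : IsTest φ φ₁ φ₂) {R : ℝ}
    (hR : 0 < R) (hsupp : ∀ x, |x| = R → φ x = 0 ∧ φ₁ x = 0) {a b : ℝ} (ha : 0 < a)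
    (hab : a ≤ b) :
    ∫ x in (-R)..R, (w x b - w x a) • φ x =
      ∫ t in a..b, ((∫ x in (-R)..R, w x t • adjointOp γ (V t) φ φ₁ φ₂ x) - V t • φ 0) := by
  have h1 := hφ.continuous
  have h2 := hφ.continuous₁
  have h3 := hφ.continuous₂
  have hwa := h.continuous_slice a
  have hwb := h.continuous_slice b
  obtain ⟨M, hM⟩ := h.bounded
  have hM0 : 0 ≤ M := (h.nonneg 0 0).trans (hM 0 0)
  have hV₀ := h.bound_nonneg
  obtain ⟨η₀, hη₀, K, hK⟩ := h.exists_bound_gradient (b := b) ha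
  have hK0 : 0 ≤ K := (abs_nonneg _).trans (hK (η₀ / 2) (by positivity)
    (by rw [abs_of_pos] <;> linarith) a ⟨le_rfl, hab⟩)
  obtain ⟨B, hB⟩ : ∃ B, ∀ x ∈ Icc (-R) R, ‖φ x‖ ≤ B ∧ ‖φ₁ x‖ ≤ B ∧ ‖φ₂ x‖ ≤ B := by
    obtain ⟨B, hB⟩ := (isCompact_Icc (a := -R) (b := R)).exists_bound_of_continuousOn h1.continuousOn
    obtain ⟨B₁, hB₁⟩ := (isCompact_Icc (a := -R) (b := R)).exists_bound_of_continuousOn h2.continuousOn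
    obtain ⟨B₂, hB₂⟩ := (isCompact_Icc (a := -R) (b := R)).exists_bound_of_continuousOn h3.continuousOn
    refine ⟨max B (max B₁ B₂), fun x hx => ⟨(hB x hx).trans (by simp), (hB₁ x hx).trans (by simp),
      (hB₂ x hx).trans (by simp)⟩⟩
  have hB0 : 0 ≤ B := (norm_nonneg _).trans (hB 0 ⟨by linarith, hR.le⟩).1
  have hadj : ∀ t, Continuous fun x => w x t • adjointOp γ (V t) φ φ₁ φ₂ x := fun t => by
    have := h.continuous_slice t
    unfold adjointOp
    fun_prop
  have hsmall : ∀ᶠ η in 𝓝[>] (0 : ℝ), 0 < η ∧ η < η₀ ∧ η < R := by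
    filter_upwards [self_mem_nhdsWithin, mem_nhdsWithin_of_mem_nhds (Iio_mem_nhds hη₀),
      mem_nhdsWithin_of_mem_nhds (Iio_mem_nhds hR)] with η e1 e2 e3
    exact ⟨e1, e2, e3⟩
  have hspace : ∀ f : ℝ → E, Continuous f →
      Tendsto (fun η => (∫ x in (-R)..(-η), f x) + ∫ x in η..R, f x) (𝓝[>] 0)
        (𝓝 (∫ x in (-R)..R, f x)) := by
    intro f hf
    have hi : ∀ a b, IntervalIntegrable f volume a b := fun a b => hf.intervalIntegrable a b
    have : Continuous fun η : ℝ => (∫ x in (-R)..(-η), f x) + ∫ x in η..R, f x := by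
      refine ((intervalIntegral.continuous_primitive hi (-R)).comp continuous_neg).add ?_
      exact (intervalIntegral.continuous_primitive hi R).neg.congr fun η =>
        (intervalIntegral.integral_symm R η).symm
    have h0 := (this.tendsto 0).mono_left (nhdsWithin_le_nhds (s := Ioi 0))
    rwa [neg_zero, intervalIntegral.integral_add_adjacent_intervals (hi _ _) (hi _ _)] at h0
  set G : ℝ → ℝ → E := fun η t => (flux w p V φ φ₁ (-η) t - flux w p V φ φ₁ η t) +
    ((∫ x in (-R)..(-η), w x t • adjointOp γ (V t) φ φ₁ φ₂ x) +
      ∫ x in η..R, w x t • adjointOp γ (V t) φ φ₁ φ₂ x) with hG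
  have hfluxR : ∀ x t, |x| = R → flux w p V φ φ₁ x t = 0 := fun x t hx => by
    simp [flux, hsupp x hx]
  have hfluxc : ∀ x, x ≠ 0 → ContinuousOn (fun t => flux w p V φ φ₁ x t) (Icc a b) :=
    fun x hx => (h.continuousOn_flux hx).mono fun t ht => ha.trans_le ht.1
  have hGc : ∀ η, 0 < η → ContinuousOn (G η) (Icc a b) := fun η hη =>
    ((hfluxc _ (by linarith)).sub (hfluxc _ hη.ne')).add
      ((h.continuous_adjoint_integral hφ _ _).add
        (h.continuous_adjoint_integral hφ _ _)).continuousOn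
  have hrect : ∀ᶠ η in 𝓝[>] (0 : ℝ), (∫ x in (-R)..(-η), (w x b - w x a) • φ x) +
      (∫ x in η..R, (w x b - w x a) • φ x) = ∫ t in a..b, G η t := by
    filter_upwards [hsmall] with η ⟨e1, _, e3⟩
    rw [h.rectangle_identity hφ ha hab (by linarith) (by rw [mem_Icc, not_and_or]; right; linarith),
      h.rectangle_identity hφ ha hab e3.le (by rw [mem_Icc, not_and_or]; left; linarith),
      ← intervalIntegral.integral_add]
    · refine intervalIntegral.integral_congr fun t _ => ?_
      simp only [hG]
      rw [hfluxR R t (abs_of_pos hR), hfluxR (-R) t (by rw [abs_neg, abs_of_pos hR])]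
      abel
    · refine ContinuousOn.intervalIntegrable ?_
      rw [uIcc_of_le hab]
      exact ((hfluxc _ (by linarith)).sub (hfluxc _ (by linarith))).add
        (h.continuous_adjoint_integral hφ _ _).continuousOn
    · refine ContinuousOn.intervalIntegrable ?_
      rw [uIcc_of_le hab]
      exact ((hfluxc _ hR.ne').sub (hfluxc _ e1.ne')).add
        (h.continuous_adjoint_integral hφ _ _).continuousOn
  refine tendsto_nhds_unique_of_eventuallyEq (hspace _ (by fun_prop)) ?_ hrect
  have hflux : ∀ x t, t ∈ Icc a b → x ≠ 0 → |x| < η₀ → |x| < R →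
      ‖flux w p V φ φ₁ x t‖ ≤ K * B + M * B + V₀ * M * B := by
    intro x t ht hx hx' hxR
    obtain ⟨b0, b1, -⟩ := hB x ⟨by linarith [neg_abs_le x], by linarith [le_abs_self x]⟩
    have hp := hK x hx hx' t ht
    have hw : |w x t| ≤ M := by rw [abs_of_nonneg (h.nonneg x t)]; exact hM x t
    have hVt := h.velocity_le t
    calc ‖flux w p V φ φ₁ x t‖ ≤ ‖p x t • φ x‖ + ‖w x t • φ₁ x‖ + ‖(V t * w x t) • φ x‖ :=
          (norm_add_le _ _).trans (add_le_add_left (norm_sub_le _ _) _)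
      _ ≤ _ := by
          simp only [norm_smul, norm_mul, Real.norm_eq_abs]
          gcongr
  refine intervalIntegral.tendsto_integral_filter_of_dominated_convergence
    (fun _ => 2 * (K * B + M * B + V₀ * M * B) + 2 * (M * ((1 + V₀ + |γ|) * B) * R)) ?_ ?_
    intervalIntegrable_const ?_
  · filter_upwards [hsmall] with η ⟨e1, _, _⟩
    rw [uIoc_of_le hab]
    exact ((hGc η e1).mono Ioc_subset_Icc_self).aestronglyMeasurable measurableSet_Ioc
  · filter_upwards [hsmall] with η ⟨e1, e2, e3⟩
    refine ae_of_all _ fun t ht => ?_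
    rw [uIoc_of_le hab] at ht
    have ht' := Ioc_subset_Icc_self ht
    have f1 := hflux (-η) t ht' (by linarith) (by rwa [abs_neg, abs_of_pos e1])
      (by rwa [abs_neg, abs_of_pos e1])
    have f2 := hflux η t ht' e1.ne' (by rwa [abs_of_pos e1]) (by rwa [abs_of_pos e1])
    have hint : ∀ c d, c ≤ d → -R ≤ c → d ≤ R → d - c ≤ R →
        ‖∫ x in c..d, w x t • adjointOp γ (V t) φ φ₁ φ₂ x‖ ≤ M * ((1 + V₀ + |γ|) * B) * R := by
      intro c d hcd hc hd hdc
      refine (intervalIntegral.norm_integral_le_of_norm_le_const fun x hx => ?_).trans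
        (mul_le_mul_of_nonneg_left (by rwa [abs_of_nonneg (sub_nonneg.2 hcd)]) (by positivity))
      rw [uIoc_of_le hcd] at hx
      obtain ⟨b0, b1, b2⟩ := hB x ⟨by linarith [hx.1], by linarith [hx.2]⟩
      exact h.norm_smul_adjointOp_le (hM x t) b0 b1 b2
    have g1 := hint (-R) (-η) (by linarith) le_rfl (by linarith) (by linarith)
    have g2 := hint η R e3.le (by linarith) le_rfl (by linarith)
    have n1 := norm_add_le (flux w p V φ φ₁ (-η) t - flux w p V φ φ₁ η t)
      ((∫ x in (-R)..(-η), w x t • adjointOp γ (V t) φ φ₁ φ₂ x) +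
        ∫ x in η..R, w x t • adjointOp γ (V t) φ φ₁ φ₂ x)
    have n2 := norm_sub_le (flux w p V φ φ₁ (-η) t) (flux w p V φ φ₁ η t)
    have n3 := norm_add_le (∫ x in (-R)..(-η), w x t • adjointOp γ (V t) φ φ₁ φ₂ x)
      (∫ x in η..R, w x t • adjointOp γ (V t) φ φ₁ φ₂ x)
    simp only [hG]
    linarith
  · refine ae_of_all _ fun t ht => ?_
    rw [uIoc_of_le hab] at ht
    have := (h.tendsto_flux_sub_flux hφ (ha.trans ht.1)).add (hspace _ (hadj t))
    rwa [neg_add_eq_sub] at this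

end IsProfile

end FreeInterface

/-! ### Truncation of test functions and the initial time -/

namespace FreeInterface

variable {E : Type*} [NormedAddCommGroup E] [NormedSpace ℝ E]

lemma exists_cutoff : ∃ (χ χ₁ χ₂ : ℝ → ℝ) (D : ℝ), IsTest χ χ₁ χ₂ ∧ χ 0 = 1 ∧
    (∀ x, |χ x| ≤ D ∧ |χ₁ x| ≤ D ∧ |χ₂ x| ≤ D) ∧
    ∀ x, 3 ≤ |x| → χ x = 0 ∧ χ₁ x = 0 ∧ χ₂ x = 0 := by
  let f : ContDiffBump (0 : ℝ) := ⟨1, 2, one_pos, one_lt_two⟩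
  have hf : ContDiff ℝ 2 (f : ℝ → ℝ) := f.contDiff
  have hf1 : ContDiff ℝ 1 (deriv (f : ℝ → ℝ)) := by
    have : ContDiff ℝ (1 + 1) (f : ℝ → ℝ) := by simpa [one_add_one_eq_two] using hf
    exact (contDiff_succ_iff_deriv.1 this).2.2
  have hf2 : Continuous (deriv (deriv (f : ℝ → ℝ))) := hf1.continuous_deriv le_rfl
  have hc0 : HasCompactSupport (f : ℝ → ℝ) := f.hasCompactSupport
  obtain ⟨D₀, h₀⟩ := hc0.exists_bound_of_continuous hf.continuous
  obtain ⟨D₁, h₁⟩ := hc0.deriv.exists_bound_of_continuous hf1.continuous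
  obtain ⟨D₂, h₂⟩ := hc0.deriv.deriv.exists_bound_of_continuous hf2
  -- The strict inequality makes the region open, so the derivatives vanish there too; hence the
  -- radius 3 in the statement, beyond the outer radius 2 of the bump.
  have hz : ∀ x : ℝ, 2 < |x| → f x = 0 := fun x hx =>
    f.zero_of_le_dist (by simpa using hx.le)
  have hev : ∀ g : ℝ → ℝ, (∀ x : ℝ, 2 < |x| → g x = 0) → ∀ x : ℝ, 2 < |x| → deriv g x = 0 := by
    intro g hg x hx
    have : g =ᶠ[𝓝 x] fun _ => 0 := by
      filter_upwards [(isOpen_lt continuous_const continuous_abs).mem_nhds hx] with y hy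
      exact hg y hy
    rw [this.deriv_eq, deriv_const]
  refine ⟨f, deriv f, deriv (deriv f), max D₀ (max D₁ D₂), ⟨fun x => ?_, fun x => ?_, hf2⟩, ?_,
    fun x => ⟨(h₀ x).trans (by simp), (h₁ x).trans (by simp), (h₂ x).trans (by simp)⟩,
    fun x hx => ⟨hz x (by linarith), hev _ hz x (by linarith), hev _ (hev _ hz) x (by linarith)⟩⟩
  · exact (hf.differentiable two_ne_zero x).hasDerivAt
  · exact (hf1.differentiable one_ne_zero x).hasDerivAt
  · exact f.one_of_mem_closedBall (by simp [f.rIn_pos.le])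

/-- Every test function is a dominated limit of compactly supported ones. -/
lemma IsTest.exists_approx {φ φ₁ φ₂ : ℝ → E} (hφ : IsTest φ φ₁ φ₂) {B : ℝ → ℝ}
    (hB : ∀ x, ‖φ x‖ ≤ B x ∧ ‖φ₁ x‖ ≤ B x ∧ ‖φ₂ x‖ ≤ B x) :
    ∃ (ψ ψ₁ ψ₂ : ℕ → ℝ → E) (C : ℝ), ∀ n, IsTest (ψ n) (ψ₁ n) (ψ₂ n) ∧
      (∃ R > 0, ∀ x, R ≤ |x| → ψ n x = 0 ∧ ψ₁ n x = 0 ∧ ψ₂ n x = 0) ∧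
      ∀ x, ‖ψ n x‖ ≤ C * B x ∧ ‖ψ₁ n x‖ ≤ C * B x ∧ ‖ψ₂ n x‖ ≤ C * B x ∧
      Tendsto (fun n => ψ n x) atTop (𝓝 (φ x)) ∧ Tendsto (fun n => ψ₁ n x) atTop (𝓝 (φ₁ x)) ∧
      Tendsto (fun n => ψ₂ n x) atTop (𝓝 (φ₂ x)) := by
  obtain ⟨χ, χ₁, χ₂, D, hχ, hχ0, hD, hsupp⟩ := exists_cutoff
  have hD0 : 0 ≤ D := (abs_nonneg _).trans (hD 0).1
  let s : ℕ → ℝ := fun n => ((n : ℝ) + 1)⁻¹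
  have hs0 : ∀ n, 0 < s n := fun n => by positivity
  have hs1 : ∀ n, s n ≤ 1 := fun n => inv_le_one_of_one_le₀ (by simp)
  have hs : Tendsto s atTop (𝓝 0) := by simpa [s] using tendsto_one_div_add_atTop_nhds_zero_nat (𝕜 := ℝ)
  have hc := hφ.continuous
  have hc1 := hφ.continuous₁
  have hc2 := hφ.continuous₂
  have kc := hχ.continuous
  have kc1 := hχ.continuous₁
  have kc2 := hχ.continuous₂
  -- Cutoff at scale `1 / s n`. Each derivative of the cutoff brings a factor `s n → 0`; the 4 is
  -- the sum `1 + 2 + 1` of the Leibniz coefficients in the second derivative.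
  refine ⟨fun n x => χ (s n * x) • φ x,
    fun n x => χ (s n * x) • φ₁ x + (s n * χ₁ (s n * x)) • φ x,
    fun n x => χ (s n * x) • φ₂ x + (2 * s n * χ₁ (s n * x)) • φ₁ x +
      (s n * (s n * χ₂ (s n * x))) • φ x, 4 * D, fun n => ⟨⟨fun x => ?_, fun x => ?_, ?_⟩,
      ⟨3 / s n, by have := hs0 n; positivity, fun x hx => ?_⟩, fun x => ?_⟩⟩
  · have h1 := (hχ.deriv (s n * x)).comp x ((hasDerivAt_id x).const_mul (s n))
    refine (h1.smul (hφ.deriv x)).congr_deriv ?_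
    simp only [Function.comp, mul_one]
    module
  · have h1 := (hχ.deriv (s n * x)).comp x ((hasDerivAt_id x).const_mul (s n))
    have h2 := ((hχ.deriv₂ (s n * x)).comp x ((hasDerivAt_id x).const_mul (s n))).const_mul (s n)
    refine ((h1.smul (hφ.deriv₂ x)).add (h2.smul (hφ.deriv x))).congr_deriv ?_
    simp only [Function.comp, mul_one]
    module
  · fun_prop
  · have : 3 ≤ |s n * x| := by
      rw [abs_mul, abs_of_pos (hs0 n)]
      rw [div_le_iff₀ (hs0 n)] at hx
      linarith
    obtain ⟨h0, h1, h2⟩ := hsupp _ this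
    simp [h0, h1, h2]
  · obtain ⟨b0, b1, b2⟩ := hB x
    obtain ⟨d0, d1, d2⟩ := hD (s n * x)
    have hBx : 0 ≤ B x := (norm_nonneg _).trans b0
    have hDB : 0 ≤ D * B x := by positivity
    have hsn := hs0 n
    have hsn1 := hs1 n
    have key : ∀ (σ τ : ℝ) (v : E), 0 ≤ σ → σ ≤ 1 → |τ| ≤ D → ‖v‖ ≤ B x →
        ‖(σ * τ) • v‖ ≤ D * B x := by
      intro σ τ v hσ hσ1 hτ hv
      rw [norm_smul, norm_mul, Real.norm_eq_abs, Real.norm_eq_abs, abs_of_nonneg hσ]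
      calc _ ≤ 1 * D * B x := by gcongr
        _ = _ := by ring
    have t1 : Tendsto (fun n => s n * x) atTop (𝓝 0) := by simpa using hs.mul_const x
    have tχ : Tendsto (fun n => χ (s n * x)) atTop (𝓝 1) := hχ0 ▸ (kc.tendsto 0).comp t1
    have tχ₁ : Tendsto (fun n => χ₁ (s n * x)) atTop (𝓝 (χ₁ 0)) := (kc1.tendsto 0).comp t1
    have tχ₂ : Tendsto (fun n => χ₂ (s n * x)) atTop (𝓝 (χ₂ 0)) := (kc2.tendsto 0).comp t1
    have k0 : ∀ v : E, ‖v‖ ≤ B x → ‖χ (s n * x) • v‖ ≤ D * B x := fun v hv => by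
      simpa using key 1 _ v zero_le_one le_rfl d0 hv
    refine ⟨?_, ?_, ?_, ?_, ?_, ?_⟩
    · linarith [k0 _ b0]
    · refine (norm_add_le _ _).trans ?_
      linarith [k0 _ b1, key (s n) _ _ hsn.le hsn1 d1 b0]
    · refine (norm_add₃_le).trans ?_
      have e : (2 * s n * χ₁ (s n * x)) • φ₁ x = (2 : ℝ) • (s n * χ₁ (s n * x)) • φ₁ x := by
        module
      have e1 := key (s n) _ _ hsn.le hsn1 d1 b1
      have e2 := key (s n * s n) _ _ (by positivity) (mul_le_one₀ hsn1 hsn.le hsn1) d2 b0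
      have e3 : ‖(2 * s n * χ₁ (s n * x)) • φ₁ x‖ ≤ 2 * (D * B x) := by
        rw [e, norm_smul, Real.norm_two]
        linarith
      rw [← mul_assoc (s n)]
      linarith [k0 _ b2]
    · simpa using tχ.smul_const (φ x)
    · simpa using (tχ.smul_const (φ₁ x)).add ((hs.mul tχ₁).smul_const (φ x))
    · simpa using ((tχ.smul_const (φ₂ x)).add (((hs.const_mul 2).mul tχ₁).smul_const (φ₁ x))).add
        ((hs.mul (hs.mul tχ₂)).smul_const (φ x))

namespace IsProfile

variable {γ V₀ : ℝ} {w p r : ℝ → ℝ → ℝ} {V : ℝ → ℝ} {φ φ₁ φ₂ : ℝ → E}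

/-- The right-hand side of the weak formulation. -/
def weakRate (γ : ℝ) (w : ℝ → ℝ → ℝ) (V : ℝ → ℝ) (φ φ₁ φ₂ : ℝ → E) (t : ℝ) : E :=
  (∫ x, w x t • adjointOp γ (V t) φ φ₁ φ₂ x) - V t • φ 0

lemma integral_eq_interval {f : ℝ → E} {R : ℝ} (hf : ∀ x, R ≤ |x| → f x = 0) :
    ∫ x, f x = ∫ x in (-R)..R, f x := by
  refine (intervalIntegral.integral_eq_integral_of_support_subset fun x hx => ?_).symm
  have : |x| < R := by
    by_contra hcon
    exact hx (hf x (not_lt.1 hcon))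
  rw [abs_lt] at this
  exact ⟨this.1, this.2.le⟩

lemma continuous_weakRate_of_compact (h : IsProfile γ V₀ w p r V) (hφ : IsTest φ φ₁ φ₂) {R : ℝ}
    (hsupp : ∀ x, R ≤ |x| → φ x = 0 ∧ φ₁ x = 0 ∧ φ₂ x = 0) :
    Continuous (weakRate γ w V φ φ₁ φ₂) := by
  have : weakRate γ w V φ φ₁ φ₂ = fun t =>
      (∫ x in (-R)..R, w x t • adjointOp γ (V t) φ φ₁ φ₂ x) - V t • φ 0 := by
    ext t
    rw [weakRate, integral_eq_interval (R := R)]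
    intro x hx
    simp [adjointOp, hsupp x hx]
  rw [this]
  exact (h.continuous_adjoint_integral hφ _ _).sub (h.continuous_velocity.smul continuous_const)

variable [CompleteSpace E]

/-- The case `a = 0` follows by continuity: with compact support both sides are continuous in `a`,
although the gradient is not controlled at time zero. -/
lemma weak_identity_of_compact (h : IsProfile γ V₀ w p r V) (hφ : IsTest φ φ₁ φ₂) {R : ℝ}
    (hR : 0 < R) (hsupp : ∀ x, R ≤ |x| → φ x = 0 ∧ φ₁ x = 0 ∧ φ₂ x = 0) {a b : ℝ} (ha : 0 ≤ a)
    (hab : a ≤ b) :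
    (∫ x, w x b • φ x) - ∫ x, w x a • φ x = ∫ t in a..b, weakRate γ w V φ φ₁ φ₂ t := by
  have hm : ∀ t, ∫ x, w x t • φ x = ∫ x in (-R)..R, w x t • φ x := fun t =>
    integral_eq_interval fun x hx => by simp [hsupp x hx]
  have hmc : Continuous fun t => ∫ x, w x t • φ x := by
    simp_rw [hm]
    refine intervalIntegral.continuous_parametric_intervalIntegral_of_continuous' ?_ _ _
    have h5 : Continuous fun q : ℝ × ℝ => w q.2 q.1 := h.continuous.comp continuous_swap
    exact h5.smul (hφ.continuous.comp continuous_snd)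
  have hKc := h.continuous_weakRate_of_compact hφ hsupp
  rcases hab.eq_or_lt with rfl | hlt
  · simp
  have hpos : EqOn (fun a => (∫ x, w x b • φ x) - ∫ x, w x a • φ x)
      (fun a => ∫ t in a..b, weakRate γ w V φ φ₁ φ₂ t) (Ioo 0 b) := by
    intro s hs
    have := h.weak_identity_interval hφ hR (fun x hx => ⟨(hsupp x hx.ge).1, (hsupp x hx.ge).2.1⟩)
      hs.1 hs.2.le
    simp only [hm]
    rw [← intervalIntegral.integral_sub]
    · simp_rw [← sub_smul]
      rw [this]
      refine intervalIntegral.integral_congr fun t _ => ?_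
      simp only [weakRate]
      rw [integral_eq_interval (R := R)]
      intro x hx
      simp [adjointOp, hsupp x hx]
    · exact ((h.continuous_slice b).smul hφ.continuous).intervalIntegrable _ _
    · exact ((h.continuous_slice s).smul hφ.continuous).intervalIntegrable _ _
  have hR' : Continuous fun a => ∫ t in a..b, weakRate γ w V φ φ₁ φ₂ t :=
    (intervalIntegral.continuous_primitive (fun c d => hKc.intervalIntegrable c d) b).neg.congr
      fun a => (intervalIntegral.integral_symm b a).symm
  refine hpos.closure (continuous_const.sub hmc) hR' ?_
  rw [closure_Ioo (ha.trans_lt hlt).ne]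
  exact ⟨ha, hab⟩

/-- The weak formulation, for test functions dominated by a weight that keeps the mass bounded. -/
theorem weak_identity (h : IsProfile γ V₀ w p r V) (hφ : IsTest φ φ₁ φ₂) {B : ℝ → ℝ} {N : ℝ}
    (hB : ∀ x, ‖φ x‖ ≤ B x ∧ ‖φ₁ x‖ ≤ B x ∧ ‖φ₂ x‖ ≤ B x) {a b : ℝ} (ha : 0 ≤ a) (hab : a ≤ b)
    (hN : ∀ t ∈ Icc a b, Integrable (fun x => w x t * B x) ∧ ∫ x, w x t * B x ≤ N) :
    (∫ x, w x b • φ x) - ∫ x, w x a • φ x = ∫ t in a..b, weakRate γ w V φ φ₁ φ₂ t := by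
  obtain ⟨ψ, ψ₁, ψ₂, C, hψ⟩ := hφ.exists_approx hB
  choose ht hR hψB using hψ
  choose R hR0 hsupp using hR
  have hw := h.continuous_slice
  have hV₀ := h.bound_nonneg
  have hlim : ∀ t ∈ Icc a b, Tendsto (fun n => ∫ x, w x t • ψ n x) atTop
      (𝓝 (∫ x, w x t • φ x)) := by
    intro t htt
    refine tendsto_integral_of_dominated_convergence (fun x => C * (w x t * B x))
      (fun n => ((hw t).smul (ht n).continuous).aestronglyMeasurable) ((hN t htt).1.const_mul C)
      (fun n => ae_of_all _ fun x => ?_) (ae_of_all _ fun x => (hψB 0 x).2.2.2.1.const_smul _)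
    rw [norm_smul, Real.norm_of_nonneg (h.nonneg x t), mul_left_comm]
    exact mul_le_mul_of_nonneg_left (hψB n x).1 (h.nonneg x t)
  have hbd : ∀ n t x, ‖w x t • adjointOp γ (V t) (ψ n) (ψ₁ n) (ψ₂ n) x‖ ≤
      (1 + V₀ + |γ|) * C * (w x t * B x) := fun n t x =>
    (h.norm_smul_adjointOp_le le_rfl (hψB n x).1 (hψB n x).2.1 (hψB n x).2.2.1).trans
      (le_of_eq (by ring))
  have hadj : ∀ t ∈ Icc a b, Tendsto (fun n => weakRate γ w V (ψ n) (ψ₁ n) (ψ₂ n) t) atTop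
      (𝓝 (weakRate γ w V φ φ₁ φ₂ t)) := by
    intro t htt
    refine Tendsto.sub ?_ ((hψB 0 0).2.2.2.1.const_smul _)
    refine tendsto_integral_of_dominated_convergence
      (fun x => (1 + V₀ + |γ|) * C * (w x t * B x))
      (fun n => Continuous.aestronglyMeasurable ?_) ((hN t htt).1.const_mul _)
      (fun n => ae_of_all _ fun x => hbd n t x) (ae_of_all _ fun x => ?_)
    · have h1 := (ht n).continuous
      have h2 := (ht n).continuous₁
      have h3 := (ht n).continuous₂
      have := hw t
      unfold adjointOp
      fun_prop
    · obtain ⟨-, -, -, l0, l1, l2⟩ := hψB 0 x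
      exact ((l2.sub (l1.const_smul _)).sub (l0.const_smul _)).const_smul _
  have hL := (hlim b ⟨hab, le_rfl⟩).sub (hlim a ⟨le_rfl, hab⟩)
  simp_rw [fun n => h.weak_identity_of_compact (ht n) (hR0 n) (hsupp n) ha hab] at hL
  refine tendsto_nhds_unique hL ?_
  refine intervalIntegral.tendsto_integral_filter_of_dominated_convergence
    (fun _ => (1 + V₀ + |γ|) * |C| * N + V₀ * (C * B 0)) (Eventually.of_forall fun n =>
      (h.continuous_weakRate_of_compact (ht n) (hsupp n)).aestronglyMeasurable)
    (Eventually.of_forall fun n => ae_of_all _ fun t htt => ?_) intervalIntegrable_const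
    (ae_of_all _ fun t htt => ?_)
  · rw [uIoc_of_le hab] at htt
    have htt' := Ioc_subset_Icc_self htt
    refine (norm_sub_le _ _).trans (add_le_add ?_ ?_)
    · refine (norm_integral_le_of_norm_le ((hN t htt').1.const_mul _)
        (ae_of_all _ fun x => hbd n t x)).trans ?_
      rw [integral_const_mul]
      have hB0 : ∀ x, 0 ≤ B x := fun x => (norm_nonneg _).trans (hB x).1
      have hI : 0 ≤ ∫ x, w x t * B x := integral_nonneg fun x => mul_nonneg (h.nonneg x t) (hB0 x)
      exact mul_le_mul (mul_le_mul_of_nonneg_left (le_abs_self C) (by positivity)) (hN t htt').2 hI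
        (by positivity)
    · rw [norm_smul]
      exact mul_le_mul (h.velocity_le t) (hψB n 0).1 (norm_nonneg _) hV₀
  · rw [uIoc_of_le hab] at htt
    exact hadj t (Ioc_subset_Icc_self htt)

end IsProfile

end FreeInterface

/-! ### Weighted mass and integrability -/

namespace FreeInterface

/-- The weight `1 / (1 + (κ x)²)`. -/
def weight (κ x : ℝ) : ℝ := (1 + (κ * x) ^ 2)⁻¹

def weight₁ (κ x : ℝ) : ℝ := -(2 * κ ^ 2 * x) * weight κ x ^ 2

def weight₂ (κ x : ℝ) : ℝ := -(2 * κ ^ 2) * weight κ x ^ 2 + 8 * κ ^ 4 * x ^ 2 * weight κ x ^ 3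

lemma weight_pos (κ x : ℝ) : 0 < weight κ x := by unfold weight; positivity

lemma weight_le_one (κ x : ℝ) : weight κ x ≤ 1 :=
  inv_le_one_of_one_le₀ (by nlinarith [sq_nonneg (κ * x)])

lemma weight_mul (κ x : ℝ) : weight κ x * (1 + (κ * x) ^ 2) = 1 :=
  inv_mul_cancel₀ (by positivity)

lemma isTest_weight (κ : ℝ) : IsTest (weight κ) (weight₁ κ) (weight₂ κ) := by
  have hd : ∀ x, HasDerivAt (weight κ) (weight₁ κ x) x := by
    intro x
    have := ((((hasDerivAt_id x).const_mul κ).pow 2).const_add 1).inv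
      (by positivity : (1 + (κ * x) ^ 2) ≠ 0)
    refine this.congr_deriv ?_
    simp only [weight₁, weight, id, Pi.pow_apply]
    norm_num
    ring
  have hc : Continuous (weight κ) := continuous_iff_continuousAt.2 fun x => (hd x).continuousAt
  refine ⟨hd, fun x => ?_, ?_⟩
  · have := (((hasDerivAt_id x).const_mul (2 * κ ^ 2)).neg).mul ((hd x).pow 2)
    refine this.congr_deriv ?_
    simp only [weight₁, weight₂, id]
    norm_num
    ring
  · unfold weight₂
    fun_prop

/-- From `2|κx| ≤ 1 + (κx)²`. The gain `κ`, and `κ²` for the second derivative, makes drift and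
diffusion small against the damping. -/
lemma abs_weight₁_le {κ : ℝ} (hκ : 0 ≤ κ) (x : ℝ) : |weight₁ κ x| ≤ κ * weight κ x := by
  have hp := weight_pos κ x
  have h1 := weight_mul κ x
  have e : weight₁ κ x = -(2 * (κ * x)) * weight κ x * (κ * weight κ x) := by
    unfold weight₁; ring
  rw [e, abs_mul, abs_of_nonneg (by positivity : 0 ≤ κ * weight κ x)]
  refine mul_le_of_le_one_left (by positivity) ?_
  rw [abs_le]
  constructor <;> nlinarith [mul_nonneg hp.le (sq_nonneg (κ * x - 1)),
    mul_nonneg hp.le (sq_nonneg (κ * x + 1))]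

lemma abs_weight₂_le (κ x : ℝ) : |weight₂ κ x| ≤ 8 * κ ^ 2 * weight κ x := by
  have hp := weight_pos κ x
  have hle := weight_le_one κ x
  have h1 := weight_mul κ x
  have e : weight₂ κ x = κ ^ 2 * weight κ x * (weight κ x * (8 * ((κ * x) ^ 2 * weight κ x) - 2)) := by
    unfold weight₂; ring
  have h2 : (κ * x) ^ 2 * weight κ x ≤ 1 := by linarith
  have h3 : 0 ≤ (κ * x) ^ 2 * weight κ x := by positivity
  have h4 : |weight κ x * (8 * ((κ * x) ^ 2 * weight κ x) - 2)| ≤ 8 := by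
    rw [abs_le]
    constructor <;> nlinarith
  rw [e, abs_mul, abs_of_nonneg (by positivity : 0 ≤ κ ^ 2 * weight κ x)]
  have := mul_le_mul_of_nonneg_left h4 (by positivity : 0 ≤ κ ^ 2 * weight κ x)
  linarith

lemma integrable_weight {κ : ℝ} (hκ : κ ≠ 0) : Integrable (weight κ) :=
  integrable_inv_one_add_sq.comp_mul_left' hκ

lemma integrable_mul_weight {f : ℝ → ℝ} (hf : Continuous f) (h0 : ∀ x, 0 ≤ f x) {M : ℝ}
    (hM : ∀ x, f x ≤ M) {κ : ℝ} (hκ : κ ≠ 0) : Integrable fun x => f x * weight κ x :=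
  (integrable_weight hκ).bdd_mul (c := M) hf.aestronglyMeasurable
    (ae_of_all _ fun x => by rw [Real.norm_of_nonneg (h0 x)]; exact hM x)

/-- A nonnegative function whose weighted integrals are bounded, uniformly as the weight tends to
one, is integrable. -/
lemma integrable_of_weighted_bound {f : ℝ → ℝ} (hf : Continuous f) (h0 : ∀ x, 0 ≤ f x) {M : ℝ}
    (hM : ∀ x, f x ≤ M) {A κ₀ : ℝ} (hκ₀ : 0 < κ₀)
    (hA : ∀ κ, 0 < κ → κ ≤ κ₀ → ∫ x, f x * weight κ x ≤ A) :
    Integrable f ∧ ∫ x, f x ≤ 2 * A := by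
  have hbd : ∀ᶠ R : ℝ in atTop, ∫ x in (-R)..R, f x ≤ 2 * A := by
    filter_upwards [eventually_ge_atTop κ₀⁻¹, eventually_gt_atTop 0] with R hR hR0
    have hκ : 0 < R⁻¹ := inv_pos.2 hR0
    have hi := integrable_mul_weight hf h0 hM hκ.ne'
    rw [intervalIntegral.integral_of_le (by linarith)]
    calc ∫ x in Ioc (-R) R, f x ≤ ∫ x in Ioc (-R) R, 2 * (f x * weight R⁻¹ x) := by
          refine setIntegral_mono_on hf.integrableOn_Ioc (hi.const_mul 2).integrableOn
            measurableSet_Ioc fun x hx => ?_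
          -- With `κ = 1/R` the weight is at least `1/2` on `[-R, R]`; this is the factor 2 of the
          -- conclusion.
          have hx' : (R⁻¹ * x) ^ 2 ≤ 1 := by
            rw [sq_le_one_iff_abs_le_one, abs_mul, abs_of_pos hκ, inv_mul_le_iff₀ hR0, mul_one, abs_le]
            exact ⟨hx.1.le, hx.2⟩
          have h1 := weight_mul R⁻¹ x
          have h2 := weight_pos R⁻¹ x
          have h3 : 1 ≤ 2 * weight R⁻¹ x := by nlinarith
          nlinarith [h0 x]
      _ ≤ ∫ x, 2 * (f x * weight R⁻¹ x) := by
          refine setIntegral_le_integral (hi.const_mul 2) (ae_of_all _ fun x => ?_)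
          have := weight_pos R⁻¹ x
          have := h0 x
          positivity
      _ = 2 * ∫ x, f x * weight R⁻¹ x := integral_const_mul _ _
      _ ≤ 2 * A := by
          gcongr
          exact hA _ hκ (inv_le_of_inv_le₀ hκ₀ hR)
  have hint : Integrable f := by
    refine integrable_of_intervalIntegral_norm_bounded (2 * A) (fun R => hf.integrableOn_Ioc)
      tendsto_neg_atTop_atBot tendsto_id ?_
    filter_upwards [hbd] with R hR
    simpa only [Real.norm_of_nonneg (h0 _), id] using hR
  exact ⟨hint, le_of_tendsto (intervalIntegral_tendsto_integral hint tendsto_neg_atTop_atBot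
    tendsto_id) hbd⟩

namespace IsProfile

variable {γ V₀ : ℝ} {w p r : ℝ → ℝ → ℝ} {V : ℝ → ℝ}

lemma weight_bound {κ : ℝ} (hκ : 0 ≤ κ) (hκ1 : κ ≤ 1) (x : ℝ) : ‖weight κ x‖ ≤ 8 * weight κ x ∧
    ‖weight₁ κ x‖ ≤ 8 * weight κ x ∧ ‖weight₂ κ x‖ ≤ 8 * weight κ x := by
  have hp := weight_pos κ x
  refine ⟨?_, (abs_weight₁_le hκ x).trans (by nlinarith), (abs_weight₂_le κ x).trans ?_⟩
  · rw [Real.norm_of_nonneg hp.le]; linarith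
  · have : κ ^ 2 ≤ 1 := pow_le_one₀ hκ hκ1
    nlinarith

/-- Decay of the weighted mass. -/
theorem integral_mul_weight_le (h : IsProfile γ V₀ w p r V) (hγ : 0 < γ) {κ : ℝ} (hκ : 0 < κ)
    (hκ1 : κ ≤ 1) (hκγ : 8 * κ ^ 2 + V₀ * κ ≤ γ / 2) {t : ℝ} (ht : 0 ≤ t) :
    ∫ x, w x t * weight κ x ≤
      Real.exp (-(γ / 2 * t)) * (∫ x, w x 0 * weight κ x) + 2 * V₀ / γ := by
  obtain ⟨M, hM⟩ := h.bounded
  have hV₀ := h.bound_nonneg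
  have hT := isTest_weight κ
  have hwi : ∀ t, Integrable fun x => w x t * weight κ x := fun t =>
    integrable_mul_weight (h.continuous_slice t) (fun x => h.nonneg x t) (fun x => hM x t) hκ.ne'
  have hadjc : ∀ t, Continuous fun x => w x t •
      adjointOp γ (V t) (weight κ) (weight₁ κ) (weight₂ κ) x := fun t => by
    have h1 := hT.continuous
    have h2 := hT.continuous₁
    have h3 := hT.continuous₂
    have := h.continuous_slice t
    unfold adjointOp
    fun_prop
  have hadjb : ∀ t x, ‖w x t • adjointOp γ (V t) (weight κ) (weight₁ κ) (weight₂ κ) x‖ ≤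
      M * ((1 + V₀ + |γ|) * (8 * weight κ x)) := fun t x => by
    obtain ⟨b0, b1, b2⟩ := weight_bound hκ.le hκ1 x
    exact h.norm_smul_adjointOp_le (hM x t) b0 b1 b2
  have hbi : Integrable fun x => M * ((1 + V₀ + |γ|) * (8 * weight κ x)) :=
    (((integrable_weight hκ.ne').const_mul 8).const_mul _).const_mul M
  set K := weakRate γ w V (weight κ) (weight₁ κ) (weight₂ κ) with hK
  have hKc : Continuous K := by
    refine Continuous.sub ?_ (h.continuous_velocity.smul continuous_const)
    refine continuous_of_dominated (fun t => (hadjc t).aestronglyMeasurable)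
      (fun t => ae_of_all _ (hadjb t)) hbi (ae_of_all _ fun x => ?_)
    have h1 := h.continuous_time x
    have h2 := h.continuous_velocity
    unfold adjointOp
    fun_prop
  -- A primitive of the continuous `K`, so differentiable everywhere; it equals the weighted mass at
  -- nonnegative times.
  set m : ℝ → ℝ := fun t => (∫ x, w x 0 * weight κ x) + ∫ s in (0 : ℝ)..t, K s with hm
  have hmw : ∀ t, 0 ≤ t → m t = ∫ x, w x t * weight κ x := by
    intro t ht
    obtain ⟨N, hN⟩ : ∃ N, ∀ s : ℝ, ∫ x, w x s * (8 * weight κ x) ≤ N := by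
      refine ⟨∫ x, M * (8 * weight κ x), fun s => integral_mono ?_
        (((integrable_weight hκ.ne').const_mul 8).const_mul M) fun x => ?_⟩
      · simpa only [mul_left_comm] using (hwi s).const_mul 8
      · have := weight_pos κ x
        exact mul_le_mul_of_nonneg_right (hM x s) (by positivity)
    have := h.weak_identity hT (weight_bound hκ.le hκ1) le_rfl ht (N := N) fun s _ =>
      ⟨by simpa only [mul_left_comm] using (hwi s).const_mul 8, hN s⟩
    simp only [smul_eq_mul] at this
    rw [hm]
    linarith
  have hmd : ∀ t, HasDerivAt m (K t) t := fun t =>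
    (intervalIntegral.integral_hasDerivAt_right (hKc.intervalIntegrable _ _)
      (hKc.stronglyMeasurableAtFilter _ _) hKc.continuousAt).const_add _
  -- Small `κ` spends at most half of the damping `γ` on the derivatives of the weight; the point
  -- source contributes at most `V₀`.
  have hKle : ∀ t, 0 ≤ t → K t ≤ -(γ / 2) * m t + V₀ := by
    intro t ht
    have h1 : ∫ x, w x t • adjointOp γ (V t) (weight κ) (weight₁ κ) (weight₂ κ) x ≤
        ∫ x, -(γ / 2) * (w x t * weight κ x) := by
      refine integral_mono (hbi.mono' (hadjc t).aestronglyMeasurable (ae_of_all _ (hadjb t)))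
        ((hwi t).const_mul _) fun x => ?_
      simp only [smul_eq_mul]
      rw [mul_left_comm]
      refine mul_le_mul_of_nonneg_left ?_ (h.nonneg x t)
      have hp := weight_pos κ x
      have a1 := abs_le.1 (abs_weight₂_le κ x)
      have a2 : |V t * weight₁ κ x| ≤ V₀ * (κ * weight κ x) := by
        rw [abs_mul]
        exact mul_le_mul (h.velocity_le t) (abs_weight₁_le hκ.le x) (abs_nonneg _) hV₀
      have a3 := abs_le.1 a2
      simp only [adjointOp, smul_eq_mul]
      nlinarith
    have h2 : -(V t * weight κ 0) ≤ V₀ := by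
      have := abs_le.1 (h.velocity_le t)
      have e : weight κ 0 = 1 := by simp [weight]
      rw [e]
      linarith
    rw [integral_const_mul, ← hmw t ht] at h1
    simp only [hK, weakRate, smul_eq_mul] at h1 ⊢
    linarith
  -- Grönwall's argument around `2 V₀ / γ`, the equilibrium of `m' = -(γ/2) m + V₀`.
  have hanti : AntitoneOn (fun t => Real.exp (γ / 2 * t) * (m t - 2 * V₀ / γ)) (Ici 0) := by
    have hd : ∀ t, HasDerivAt (fun t => Real.exp (γ / 2 * t) * (m t - 2 * V₀ / γ))
        (Real.exp (γ / 2 * t) * (γ / 2) * (m t - 2 * V₀ / γ) + Real.exp (γ / 2 * t) * K t) t :=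
      fun t => by
        have := ((hasDerivAt_id t).const_mul (γ / 2)).exp.mul ((hmd t).sub_const (2 * V₀ / γ))
        exact this.congr_deriv (by simp)
    refine antitoneOn_of_deriv_nonpos (convex_Ici 0)
      (fun t _ => (hd t).continuousAt.continuousWithinAt)
      (fun t _ => (hd t).differentiableAt.differentiableWithinAt) fun t ht => ?_
    rw [interior_Ici] at ht
    rw [(hd t).deriv]
    have := hKle t (le_of_lt ht)
    have e : Real.exp (γ / 2 * t) * (γ / 2) * (m t - 2 * V₀ / γ) + Real.exp (γ / 2 * t) * K t =
        Real.exp (γ / 2 * t) * (K t - (-(γ / 2) * m t + V₀)) := by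
      field_simp
      ring
    rw [e]
    exact mul_nonpos_of_nonneg_of_nonpos (Real.exp_pos _).le (by linarith)
  have h1 := hanti (mem_Ici.2 le_rfl) (mem_Ici.2 ht) ht
  simp only [mul_zero, Real.exp_zero, one_mul] at h1
  have h2 := mul_le_mul_of_nonneg_left h1 (Real.exp_pos (-(γ / 2 * t))).le
  rw [← mul_assoc, ← Real.exp_add, neg_add_cancel, Real.exp_zero, one_mul, hmw t ht, hmw 0 le_rfl,
    mul_sub] at h2
  have : 0 ≤ Real.exp (-(γ / 2 * t)) * (2 * V₀ / γ) := by positivity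
  linarith

lemma exists_small_weight (hγ : 0 < γ) (hV₀ : 0 ≤ V₀) : ∃ κ₀ > 0, ∀ κ, 0 < κ → κ ≤ κ₀ →
    κ ≤ 1 ∧ 8 * κ ^ 2 + V₀ * κ ≤ γ / 2 := by
  refine ⟨min 1 (γ / 2 / (8 + V₀)), by positivity, fun κ hκ hle => ?_⟩
  have h1 := hle.trans (min_le_left _ _)
  have h2 := hle.trans (min_le_right _ _)
  rw [le_div_iff₀ (by positivity)] at h2
  exact ⟨h1, by nlinarith⟩

/-- Integrability of the temperature is propagated in time. -/
theorem integrable_slice (h : IsProfile γ V₀ w p r V) (hγ : 0 < γ)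
    (h0 : Integrable fun x => w x 0) {t : ℝ} (ht : 0 ≤ t) :
    Integrable (fun x => w x t) ∧ ∫ x, w x t ≤ 2 * ((∫ x, w x 0) + 2 * V₀ / γ) := by
  obtain ⟨M, hM⟩ := h.bounded
  obtain ⟨κ₀, hκ₀, hκ⟩ := exists_small_weight hγ h.bound_nonneg
  refine integrable_of_weighted_bound (h.continuous_slice t) (fun x => h.nonneg x t)
    (fun x => hM x t) hκ₀ fun κ hκ0 hκle => ?_
  obtain ⟨k1, k2⟩ := hκ κ hκ0 hκle
  refine (h.integral_mul_weight_le hγ hκ0 k1 k2 ht).trans (add_le_add_left ?_ _)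
  have hnn : 0 ≤ ∫ x, w x 0 * weight κ x :=
    integral_nonneg fun x => mul_nonneg (h.nonneg x 0) (weight_pos κ x).le
  calc _ ≤ 1 * ∫ x, w x 0 * weight κ x := by
        refine mul_le_mul_of_nonneg_right (Real.exp_le_one_iff.2 ?_) hnn
        have : 0 ≤ γ / 2 * t := by positivity
        linarith
    _ ≤ ∫ x, w x 0 := by
        rw [one_mul]
        refine integral_mono (integrable_mul_weight (h.continuous_slice 0) (fun x => h.nonneg x 0)
          (fun x => hM x 0) hκ0.ne') h0 fun x => ?_
        exact mul_le_of_le_one_right (h.nonneg x 0) (weight_le_one κ x)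

end IsProfile

end FreeInterface

/-! ### From profiles to Fourier modes -/

namespace FreeInterface

open scoped FourierTransform

/-- The oscillating exponential of the Fourier transform. -/
def fourierExp (ξ x : ℝ) : ℂ := Complex.exp ((-2 * Real.pi * x * ξ : ℝ) * Complex.I)

/-- The logarithmic derivative of `fourierExp`. -/
def fourierSlope (ξ : ℝ) : ℂ := (-2 * Real.pi * ξ : ℝ) * Complex.I

lemma norm_fourierExp (ξ x : ℝ) : ‖fourierExp ξ x‖ = 1 := Complex.norm_exp_ofReal_mul_I _

lemma isTest_fourierExp (ξ : ℝ) : IsTest (fourierExp ξ)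
    (fun x => fourierSlope ξ * fourierExp ξ x) (fun x => fourierSlope ξ ^ 2 * fourierExp ξ x) := by
  have hd : ∀ x, HasDerivAt (fourierExp ξ) (fourierSlope ξ * fourierExp ξ x) x := by
    intro x
    have := (((hasDerivAt_id x).const_mul (-2 * Real.pi)).mul_const ξ).ofReal_comp.mul_const
      Complex.I
    refine this.cexp.congr_deriv ?_
    simp only [fourierExp, fourierSlope, id]
    push_cast
    ring
  refine ⟨hd, fun x => ((hd x).const_mul (fourierSlope ξ)).congr_deriv (by ring), ?_⟩
  unfold fourierExp
  fun_prop

lemma norm_fourierExp_le (ξ : ℝ) (x : ℝ) :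
    ‖fourierExp ξ x‖ ≤ 1 + ‖fourierSlope ξ‖ + ‖fourierSlope ξ‖ ^ 2 ∧
    ‖fourierSlope ξ * fourierExp ξ x‖ ≤ 1 + ‖fourierSlope ξ‖ + ‖fourierSlope ξ‖ ^ 2 ∧
    ‖fourierSlope ξ ^ 2 * fourierExp ξ x‖ ≤ 1 + ‖fourierSlope ξ‖ + ‖fourierSlope ξ‖ ^ 2 := by
  have h1 := norm_nonneg (fourierSlope ξ)
  have h2 := sq_nonneg ‖fourierSlope ξ‖
  simp only [norm_mul, norm_pow, norm_fourierExp, mul_one]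
  exact ⟨by linarith, by linarith, by linarith⟩

/-- The Fourier transform of the temperature profile. -/
def mode (w : ℝ → ℝ → ℝ) (ξ t : ℝ) : ℂ := ∫ x, w x t • fourierExp ξ x

lemma mode_eq_fourier (w : ℝ → ℝ → ℝ) (ξ t : ℝ) : mode w ξ t = 𝓕 (fun x => (w x t : ℂ)) ξ := by
  rw [Real.fourier_real_eq_integral_exp_smul]
  refine integral_congr_ae (ae_of_all _ fun x => ?_)
  simp [fourierExp, mul_comm]

namespace IsProfile

variable {γ V₀ : ℝ} {w p r w₁ p₁ r₁ w₂ p₂ r₂ : ℝ → ℝ → ℝ} {V V₁ V₂ : ℝ → ℝ}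

/-- The exponentials are eigenfunctions of `adjointOp`, and their value 1 at the interface turns the
point source into `-V`. -/
lemma weakRate_fourierExp (t ξ : ℝ) :
    weakRate γ w V (fourierExp ξ) (fun x => fourierSlope ξ * fourierExp ξ x)
      (fun x => fourierSlope ξ ^ 2 * fourierExp ξ x) t =
    (-(modeRate γ ξ : ℂ) + (2 * Real.pi * ξ * V t : ℝ) * Complex.I) * mode w ξ t +
      (-(V t : ℂ)) := by
  have h1 : ∀ x, w x t • adjointOp γ (V t) (fourierExp ξ)
      (fun x => fourierSlope ξ * fourierExp ξ x) (fun x => fourierSlope ξ ^ 2 * fourierExp ξ x) x =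
      (-(modeRate γ ξ : ℂ) + (2 * Real.pi * ξ * V t : ℝ) * Complex.I) *
        (w x t • fourierExp ξ x) := by
    intro x
    simp only [adjointOp, Complex.real_smul, fourierSlope, modeRate]
    push_cast
    linear_combination (4 * (w x t : ℂ) * Real.pi ^ 2 * ξ ^ 2 * fourierExp ξ x) * Complex.I_sq
  have h2 : fourierExp ξ 0 = 1 := by simp [fourierExp]
  rw [weakRate, integral_congr_ae (ae_of_all _ h1), integral_const_mul, h2, mode]
  simp [sub_eq_add_neg]

lemma norm_mode_le (h : IsProfile γ V₀ w p r V) (ξ t : ℝ) : ‖mode w ξ t‖ ≤ ∫ x, w x t := by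
  refine (norm_integral_le_integral_norm _).trans (le_of_eq ?_)
  congr 1
  ext x
  rw [norm_smul, norm_fourierExp, mul_one, Real.norm_of_nonneg (h.nonneg x t)]

theorem isFourierSolution (h : IsProfile γ V₀ w p r V) (hγ : 0 < γ)
    (h0 : Integrable fun x => w x 0) {N : ℝ} (hN : 2 * ((∫ x, w x 0) + 2 * V₀ / γ) ≤ N) :
    IsFourierSolution γ V₀ N V (mode w) := by
  have hle : ∀ ξ t, 0 ≤ t → ‖mode w ξ t‖ ≤ N := fun ξ t ht =>
    (h.norm_mode_le ξ t).trans ((h.integrable_slice hγ h0 ht).2.trans hN)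
  refine ⟨h.continuous_velocity, h.velocity_le, fun ξ t ht => ?_, fun ξ t ht => hle ξ t ht.le,
    fun t ht => ?_⟩
  · set K : ℝ → ℂ := fun t => (-(modeRate γ ξ : ℂ) + (2 * Real.pi * ξ * V t : ℝ) * Complex.I) *
      mode w ξ t + (-(V t : ℂ)) with hK
    set D : ℝ := 1 + ‖fourierSlope ξ‖ + ‖fourierSlope ξ‖ ^ 2 with hD
    have hD0 : 0 ≤ D := by positivity
    have hweak : ∀ a b, 0 ≤ a → a ≤ b → mode w ξ b - mode w ξ a = ∫ s in a..b, K s := by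
      intro a b ha hab
      have := h.weak_identity (isTest_fourierExp ξ) (B := fun _ => D) (N := N * D)
        (norm_fourierExp_le ξ) ha hab fun s hs => by
          obtain ⟨i1, i2⟩ := h.integrable_slice hγ h0 (ha.trans hs.1)
          refine ⟨i1.mul_const _, ?_⟩
          rw [integral_mul_const]
          exact mul_le_mul_of_nonneg_right (i2.trans hN) hD0
      rw [mode, mode, this]
      refine intervalIntegral.integral_congr fun s hs => ?_
      rw [uIcc_of_le hab] at hs
      exact weakRate_fourierExp s ξ
    have hN0 : 0 ≤ N := (norm_nonneg _).trans (hle ξ 0 le_rfl)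
    have hV₀ := h.bound_nonneg
    obtain ⟨C, hC⟩ : ∃ C, ∀ t, 0 ≤ t → ‖K t‖ ≤ C := by
      refine ⟨(modeRate γ ξ + |2 * Real.pi * ξ| * V₀) * N + V₀, fun t ht => ?_⟩
      have hm := modeRate_pos hγ ξ
      have hV := h.velocity_le t
      refine (norm_add_le _ _).trans (add_le_add ?_ ?_)
      · rw [norm_mul]
        refine mul_le_mul ((norm_add_le _ _).trans (add_le_add ?_ ?_)) (hle ξ t ht)
          (norm_nonneg _) (by positivity)
        · rw [norm_neg, Complex.norm_real, Real.norm_of_nonneg hm.le]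
        · rw [norm_mul, Complex.norm_I, mul_one, Complex.norm_real, Real.norm_eq_abs, abs_mul]
          gcongr
      · rwa [norm_neg, Complex.norm_real]
    -- Bootstrap: the integrated identity with bounded `K` makes the mode Lipschitz, hence `K`
    -- continuous, hence the mode differentiable.
    have hlip : ContinuousOn (mode w ξ) (Ici 0) := by
      have : LipschitzOnWith (Real.toNNReal C) (mode w ξ) (Ici 0) := by
        have key : ∀ a b, 0 ≤ a → a ≤ b → ‖mode w ξ b - mode w ξ a‖ ≤ C * (b - a) := by
          intro a b ha hab
          rw [hweak a b ha hab, ← abs_of_nonneg (sub_nonneg.2 hab)]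
          refine intervalIntegral.norm_integral_le_of_norm_le_const fun s hs => ?_
          rw [uIoc_of_le hab] at hs
          exact hC s (ha.trans hs.1.le)
        have hC0 : 0 ≤ C := (norm_nonneg _).trans (hC 0 le_rfl)
        refine LipschitzOnWith.of_dist_le_mul fun x hx y hy => ?_
        rw [Real.coe_toNNReal C hC0, dist_eq_norm, Real.dist_eq]
        rcases le_total x y with hxy | hxy
        · rw [norm_sub_rev, abs_sub_comm, abs_of_nonneg (sub_nonneg.2 hxy)]
          exact key x y hx hxy
        · rw [abs_of_nonneg (sub_nonneg.2 hxy)]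
          exact key y x hy hxy
      exact this.continuousOn
    have hKc : ContinuousOn K (Ici 0) := by
      have := h.continuous_velocity
      fun_prop
    have hd : HasDerivAt (fun b => mode w ξ 0 + ∫ s in (0 : ℝ)..b, K s) (K t) t := by
      refine (intervalIntegral.integral_hasDerivAt_right ?_ ?_ ?_).const_add _
      · refine ContinuousOn.intervalIntegrable (hKc.mono ?_)
        rw [uIcc_of_le ht.le]
        exact Icc_subset_Ici_self
      · exact (hKc.mono Ioi_subset_Ici_self).stronglyMeasurableAtFilter isOpen_Ioi t ht
      · exact hKc.continuousAt (Ici_mem_nhds ht)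
    refine hd.congr_of_eventuallyEq ?_
    filter_upwards [Ici_mem_nhds ht] with b hb
    rw [← hweak 0 b le_rfl hb]
    ring
  · obtain ⟨i1, -⟩ := h.integrable_slice hγ h0 ht.le
    have : Continuous (𝓕 (fun x => (w x t : ℂ))) :=
      VectorFourier.fourierIntegral_continuous Real.continuous_fourierChar
        (by exact continuous_inner) i1.ofReal
    exact this.congr fun ξ => (mode_eq_fourier w ξ t).symm

lemma fourierInv_mode (h : IsProfile γ V₀ w p r V) {t : ℝ} (hi : Integrable fun x => w x t)
    (hm : Integrable fun ξ => mode w ξ t) (x : ℝ) :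
    𝓕⁻ (fun ξ => mode w ξ t) x = w x t := by
  have e : (fun ξ => mode w ξ t) = 𝓕 (fun x => (w x t : ℂ)) := funext fun ξ => mode_eq_fourier w ξ t
  rw [e] at hm ⊢
  exact congrFun (Continuous.fourierInv_fourier_eq
    (Complex.continuous_ofReal.comp (h.continuous_slice t)) hi.ofReal hm) x

/-- Backward uniqueness for integrable profiles. -/
theorem eq_of_eq (h₁ : IsProfile γ V₀ w₁ p₁ r₁ V₁) (h₂ : IsProfile γ V₀ w₂ p₂ r₂ V₂) (hγ : 0 < γ)
    (i₁ : Integrable fun x => w₁ x 0) (i₂ : Integrable fun x => w₂ x 0) {L : ℝ}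
    (hL : ∀ t, 0 < t → |V₁ t - V₂ t| ≤ L * |w₁ 0 t - w₂ 0 t|) {T : ℝ} (hT0 : 0 ≤ T)
    (hT : ∀ x, w₁ x T = w₂ x T) (x : ℝ) : w₁ x 0 = w₂ x 0 := by
  rcases hT0.eq_or_lt with rfl | hT0
  · exact hT x
  have f₁ := h₁.isFourierSolution hγ i₁ (le_max_left _ (2 * ((∫ x, w₂ x 0) + 2 * V₀ / γ)))
  have f₂ := h₂.isFourierSolution hγ i₂ (le_max_right (2 * ((∫ x, w₁ x 0) + 2 * V₀ / γ)) _)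
  have hinv₁ : ∀ t, 0 < t → ∀ x, 𝓕⁻ (fun ξ => mode w₁ ξ t) x = w₁ x t := fun t ht =>
    h₁.fourierInv_mode (h₁.integrable_slice hγ i₁ ht.le).1 (f₁.integrable hγ ht)
  have hinv₂ : ∀ t, 0 < t → ∀ x, 𝓕⁻ (fun ξ => mode w₂ ξ t) x = w₂ x t := fun t ht =>
    h₂.fourierInv_mode (h₂.integrable_slice hγ i₂ ht.le).1 (f₂.integrable hγ ht)
  have hmT : ∀ ξ, mode w₁ ξ T = mode w₂ ξ T := fun ξ => by simp only [mode, hT]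
  -- Fourier inversion at `x = 0`, where the exponential is 1.
  have htrace : ∀ t, 0 < t → |w₁ 0 t - w₂ 0 t| ≤ ∫ ξ, ‖mode w₁ ξ t - mode w₂ ξ t‖ := by
    intro t ht
    have e1 := hinv₁ t ht 0
    have e2 := hinv₂ t ht 0
    rw [Real.fourierInv_eq'] at e1 e2
    simp only [inner_zero_right, mul_zero, Complex.ofReal_zero, zero_mul, Complex.exp_zero,
      one_smul] at e1 e2
    have e3 : ((w₁ 0 t - w₂ 0 t : ℝ) : ℂ) = ∫ ξ, (mode w₁ ξ t - mode w₂ ξ t) := by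
      rw [integral_sub (f₁.integrable hγ ht) (f₂.integrable hγ ht), e1, e2]
      push_cast
      rfl
    rw [← Real.norm_eq_abs, ← Complex.norm_real, e3]
    exact norm_integral_le_integral_norm _
  have hq := fun t (ht : t ∈ Ioc 0 T) => f₁.trace_eq_zero f₂ hγ (L := L)
    (q := fun t => w₁ 0 t - w₂ 0 t) ((h₁.continuous_time 0).sub (h₂.continuous_time 0)) hL htrace
    hmT ht
  have hV : ∀ t ∈ Ioc 0 T, V₁ t = V₂ t := fun t ht => by
    have := hL t ht.1
    rw [hq t ht, abs_zero, mul_zero] at this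
    exact sub_eq_zero.1 (abs_eq_zero.1 (le_antisymm this (abs_nonneg _)))
  have hw : EqOn (fun t => w₁ x t) (fun t => w₂ x t) (Ioo 0 T) := by
    intro t ht
    have e : (fun ξ => mode w₁ ξ t) = fun ξ => mode w₂ ξ t :=
      funext fun ξ => f₁.eq_of_eq f₂ hV hmT ⟨ht.1, ht.2.le⟩ ξ
    have := (hinv₁ t ht.1 x).symm.trans ((congrArg (fun f : ℝ → ℂ => 𝓕⁻ f x) e).trans (hinv₂ t ht.1 x))
    exact_mod_cast this
  refine hw.closure (h₁.continuous_time x) (h₂.continuous_time x) ?_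
  rw [closure_Ioo hT0.ne]
  exact ⟨le_rfl, hT0.le⟩

end IsProfile

end FreeInterface

/-! ### Classical solutions in the moving frame, and the attractor -/

namespace FreeInterface

/-- The interface velocity, extended by a constant to negative times. -/
def velocityExt (v : ℝ → ℝ) (t : ℝ) : ℝ := v (max t 0)

/-- A function of `(x, t)` in the frame attached to the interface, extended by a constant to
negative times. -/
def movingFrame (v : ℝ → ℝ) (f : ℝ → ℝ → ℝ) (x t : ℝ) : ℝ := f (x + front v (max t 0)) (max t 0)

lemma movingFrame_of_nonneg (v : ℝ → ℝ) (f : ℝ → ℝ → ℝ) (x : ℝ) {t : ℝ} (ht : 0 ≤ t) :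
    movingFrame v f x t = f (x + front v t) t := by
  rw [movingFrame, max_eq_left ht]

namespace IsClassicalSolution

variable {γ v₀ V₀ : ℝ} {g u₀ v : ℝ → ℝ} {u : ℝ → ℝ → ℝ}

lemma continuous_velocityExt (h : IsClassicalSolution γ g u₀ u v) : Continuous (velocityExt v) :=
  h.continuous_v.comp_continuous (by fun_prop) fun t => le_max_right t 0

lemma hasDerivAt_front_velocityExt (h : IsClassicalSolution γ g u₀ u v) (t : ℝ) :
    HasDerivAt (front (velocityExt v)) (velocityExt v t) t :=
  intervalIntegral.integral_hasDerivAt_right (h.continuous_velocityExt.intervalIntegrable _ _)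
    (h.continuous_velocityExt.stronglyMeasurableAtFilter _ _) h.continuous_velocityExt.continuousAt

lemma continuous_front_velocityExt (h : IsClassicalSolution γ g u₀ u v) :
    Continuous (front (velocityExt v)) :=
  continuous_iff_continuousAt.2 fun t => (h.hasDerivAt_front_velocityExt t).continuousAt

end IsClassicalSolution

lemma front_velocityExt (v : ℝ → ℝ) {t : ℝ} (ht : 0 ≤ t) : front (velocityExt v) t = front v t := by
  refine intervalIntegral.integral_congr fun s hs => ?_
  rw [uIcc_of_le ht] at hs
  simp [velocityExt, max_eq_left hs.1]

namespace IsClassicalSolution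

variable {γ v₀ V₀ : ℝ} {g u₀ v : ℝ → ℝ} {u : ℝ → ℝ → ℝ}

/-- The change of variables from the moving frame to the laboratory frame. -/
lemma continuous_frameMap (h : IsClassicalSolution γ g u₀ u v) :
    Continuous fun z : ℝ × ℝ => (z.1 + front v (max z.2 0), max z.2 0) := by
  have h1 := h.continuous_front_velocityExt
  have : (fun z : ℝ × ℝ => (z.1 + front v (max z.2 0), max z.2 0)) =
      fun z : ℝ × ℝ => (z.1 + front (velocityExt v) (max z.2 0), max z.2 0) := by
    ext z
    · rw [front_velocityExt v (le_max_right _ _)]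
    · rfl
  rw [this]
  fun_prop

lemma isOpen_offFront (h : IsClassicalSolution γ g u₀ u v) : IsOpen (offFront v) := by
  have h1 := h.continuous_front_velocityExt
  have : offFront v = {p : ℝ × ℝ | 0 < p.2} ∩ {p | p.1 ≠ front (velocityExt v) p.2} := by
    ext p
    simp only [offFront, mem_ofPred_eq, mem_inter_iff]
    refine and_congr_right fun hp => ?_
    rw [front_velocityExt v hp.le]
  rw [this]
  exact (isOpen_lt continuous_const continuous_snd).inter
    (isOpen_ne_fun continuous_fst (h1.comp continuous_snd))

lemma frameMap_mem (v : ℝ → ℝ) {x t : ℝ} (ht : 0 < t) (hx : x ≠ 0) :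
    (x + front v (max t 0), max t 0) ∈ offFront v := by
  refine ⟨lt_max_of_lt_left ht, ?_⟩
  simpa using hx

/-- Continuous partial derivatives on the open set `offFront v` make `u` jointly differentiable, so
the chain rule applies along `s ↦ (x + front v s, s)`. -/
lemma hasDerivAt_movingFrame_t (h : IsClassicalSolution γ g u₀ u v) {x t : ℝ} (ht : 0 < t)
    (hx : x ≠ 0) : HasDerivAt (fun s => movingFrame v u x s)
      (dt u (x + front v t) t + v t * dx u (x + front v t) t) t := by
  have hmem : (x + front v t, t) ∈ offFront v := ⟨ht, by simpa using hx⟩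
  have hopen := h.isOpen_offFront.mem_nhds hmem
  have hF : HasStrictFDerivAt ↿u _ (x + front v t, t) :=
    hasStrictFDerivAt_uncurry_coprod (u := (x + front v t, t)) (f := u)
      (f₁ := fun a b => ContinuousLinearMap.toSpanSingleton ℝ (dx u a b))
      (f₂ := fun a b => ContinuousLinearMap.toSpanSingleton ℝ (dt u a b))
      (by
        filter_upwards [hopen] with z hz
        exact (h.differentiable_x z hz).hasDerivAt.hasFDerivAt)
      (by
        filter_upwards [hopen] with z hz
        exact (h.differentiable_t z hz).hasDerivAt.hasFDerivAt)
      (((ContinuousLinearMap.toSpanSingletonCLE (𝕜 := ℝ) (E := ℝ)).continuous.continuousAt).comp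
        (h.continuous_dx.continuousAt hopen))
      (((ContinuousLinearMap.toSpanSingletonCLE (𝕜 := ℝ) (E := ℝ)).continuous.continuousAt).comp
        (h.continuous_dt.continuousAt hopen))
  have hs : HasDerivAt (fun s => (x + front (velocityExt v) s, s)) (v t, 1) t := by
    have := ((h.hasDerivAt_front_velocityExt t).const_add x).prodMk (hasDerivAt_id t)
    simpa [velocityExt, max_eq_left ht.le] using! this
  have hF' := hF.hasFDerivAt
  rw [← front_velocityExt v ht.le] at hF' ⊢
  have := HasFDerivAt.comp_hasDerivAt (f := fun s => (x + front (velocityExt v) s, s)) t hF' hs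
  refine (this.congr_deriv ?_).congr_of_eventuallyEq ?_
  · simp [Function.HasUncurry.uncurry]
    ring
  · filter_upwards [Ioi_mem_nhds ht] with s hs
    rw [movingFrame_of_nonneg v u x (le_of_lt hs), ← front_velocityExt v (le_of_lt hs)]
    rfl

lemma velocity_le (h : IsClassicalSolution γ g u₀ u v) (hg : IsKinetics v₀ V₀ g) (hv₀ : 0 < v₀)
    (t : ℝ) : |velocityExt v t| ≤ V₀ := by
  have hpos : ∀ t, 0 < t → |velocityExt v t| ≤ V₀ := by
    intro t ht
    rw [velocityExt, max_eq_left ht.le, ← h.kinetic t ht]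
    have hu := h.nonneg (front v t) t ht.le
    rw [abs_le]
    exact ⟨hg.lower _ hu, by linarith [hg.upper _ hu, hg.lower _ hu]⟩
  have hcl : IsClosed {t | |velocityExt v t| ≤ V₀} :=
    isClosed_le h.continuous_velocityExt.abs continuous_const
  have hsub : Ioi (0 : ℝ) ⊆ {t | |velocityExt v t| ≤ V₀} := fun t ht => hpos t ht
  -- The kinetic condition holds only for positive times; time zero is reached by continuity.
  have h0 : |velocityExt v 0| ≤ V₀ :=
    hcl.closure_subset_iff.2 hsub (by rw [closure_Ioi]; exact mem_Ici.2 le_rfl)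
  rcases lt_or_ge 0 t with ht | ht
  · exact hpos t ht
  · simpa [velocityExt, max_eq_right ht] using h0

/-- A classical solution, read in the frame attached to the interface. -/
theorem isProfile (h : IsClassicalSolution γ g u₀ u v) (hg : IsKinetics v₀ V₀ g) (hv₀ : 0 < v₀) :
    IsProfile γ V₀ (movingFrame v u) (movingFrame v (dx u)) (movingFrame v (dxx u))
      (velocityExt v) where
  continuous := h.continuous_u.comp_continuous h.continuous_frameMap fun z => le_max_right z.2 0
  continuous_velocity := h.continuous_velocityExt
  velocity_le := h.velocity_le hg hv₀
  nonneg x t := h.nonneg _ _ (le_max_right t 0)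
  bounded := by
    obtain ⟨M, hM⟩ := h.bounded
    exact ⟨M, fun x t => hM _ _ (le_max_right t 0)⟩
  hasDerivAt_x x t ht hx :=
    (h.differentiable_x _ (frameMap_mem v ht hx)).hasDerivAt.comp_add_const x _
  hasDerivAt_xx x t ht hx :=
    (h.differentiable_xx _ (frameMap_mem v ht hx)).hasDerivAt.comp_add_const x _
  hasDerivAt_t x t ht hx := by
    refine (h.hasDerivAt_movingFrame_t ht hx).congr_deriv ?_
    have := h.heat _ (frameMap_mem v ht hx)
    simp only [max_eq_left ht.le] at this
    rw [this]
    simp only [movingFrame, velocityExt, max_eq_left ht.le]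
    ring
  continuousOn_p := h.continuous_dx.comp h.continuous_frameMap.continuousOn
    fun z hz => frameMap_mem v hz.2 hz.1
  continuousOn_r := h.continuous_dxx.comp h.continuous_frameMap.continuousOn
    fun z hz => frameMap_mem v hz.2 hz.1
  jump t ht := by
    obtain ⟨l, l', hl, hl', hj⟩ := h.jump t ht
    have hc : Tendsto (fun z : ℝ × ℝ => (z.1 + front v (max z.2 0), max z.2 0)) (𝓝 (0, t))
        (𝓝 (front v t, t)) := by
      have := h.continuous_frameMap.tendsto (0, t)
      simpa [max_eq_left ht.le] using this
    refine ⟨l, l', hl.comp (tendsto_nhdsWithin_iff.2 ⟨hc.mono_left nhdsWithin_le_nhds, ?_⟩),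
      hl'.comp (tendsto_nhdsWithin_iff.2 ⟨hc.mono_left nhdsWithin_le_nhds, ?_⟩), ?_⟩
    · filter_upwards [self_mem_nhdsWithin] with z hz
      simpa using hz
    · filter_upwards [self_mem_nhdsWithin] with z hz
      simpa using hz
    · rw [hj, velocityExt, max_eq_left ht.le]

lemma movingFrame_zero (h : IsClassicalSolution γ g u₀ u v) (x : ℝ) : movingFrame v u x 0 = u₀ x := by
  rw [movingFrame_of_nonneg v u x le_rfl, ← h.initial x]
  simp [front]

end IsClassicalSolution

lemma IsKinetics.exists_lipschitz {v₀ V₀ : ℝ} {g : ℝ → ℝ} (hg : IsKinetics v₀ V₀ g) :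
    ∃ L, ∀ x y, 0 ≤ x → 0 ≤ y → |g x - g y| ≤ L * |x - y| := by
  obtain ⟨C, hC⟩ := hg.deriv_bounded
  exact ⟨C, fun x y hx hy => (convex_Ici (0 : ℝ)).norm_image_sub_le_of_norm_derivWithin_le
    hg.differentiable hC hy hx⟩

lemma weightedNorm_zero_le {α : ℝ} (hα : 0 ≤ α) (f : ℝ → ℝ) (x : ℝ) :
    ENNReal.ofReal |f x| ≤ weightedNorm α f := by
  refine le_trans (ENNReal.ofReal_le_ofReal ?_) (le_iSup (fun x =>
    ENNReal.ofReal (Real.exp (α * |x|) * |f x|)) x)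
  exact le_mul_of_one_le_left (abs_nonneg _) (Real.one_le_exp (by positivity))

/-- Temperatures on the attractor are integrable. -/
theorem integrable_of_mem_attractor {γ v₀ V₀ α ε : ℝ} {g u₀ : ℝ → ℝ} (hγ : 0 < γ) (hv₀ : 0 < v₀)
    (hg : IsKinetics v₀ V₀ g) (hV₀ : 0 ≤ V₀) (hα : 0 ≤ α) (hε : 0 ≤ ε) (h0 : ∀ x, 0 ≤ u₀ x)
    (hu₀ : u₀ ∈ attractor γ g V₀ α ε) : Integrable u₀ := by
  obtain ⟨⟨hc, hfin⟩, hA⟩ := hu₀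
  have hM : ∀ x, u₀ x ≤ (weightedNorm α u₀).toReal := fun x => by
    have := (ENNReal.ofReal_le_iff_le_toReal hfin.ne).1 (weightedNorm_zero_le hα u₀ x)
    exact (le_abs_self _).trans this
  obtain ⟨κ₀, hκ₀, hκ⟩ := IsProfile.exists_small_weight hγ hV₀
  refine (integrable_of_weighted_bound hc h0 hM (A := 2 * V₀ / γ) hκ₀ fun κ hκ0 hκle => ?_).1
  obtain ⟨k1, k2⟩ := hκ κ hκ0 hκle
  set W : ℝ := ∫ x, weight κ x with hW
  have hWi := integrable_weight hκ0.ne'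
  have hW0 : 0 ≤ W := integral_nonneg fun x => (weight_pos κ x).le
  set K : ℝ := V₀ / √γ + ε with hK
  have hK0 : 0 ≤ K := by positivity
  -- Compare `u₀` with an orbit from the absorbing ball at a time `t ≥ s`: `K * W` bounds the
  -- initial weighted mass uniformly over the ball, and `δ * W` is the approximation error.
  have hbound : ∀ s : ℝ, 0 ≤ s → ∀ δ : ℝ, 0 < δ → ∫ x, u₀ x * weight κ x ≤
      Real.exp (-(γ / 2 * s)) * (K * W) + 2 * V₀ / γ + δ * W := by
    intro s hs δ hδ
    obtain ⟨t, hst, b, ⟨⟨-, hbfin⟩, hb0, hbK⟩, ψ, ⟨u, v, hsol, hψ⟩, hclose⟩ := hA s hs δ hδ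
    have ht : 0 ≤ t := hs.trans hst
    have hP := hsol.isProfile hg hv₀
    obtain ⟨M, hM'⟩ := hP.bounded
    have hi := fun t => integrable_mul_weight (hP.continuous_slice t) (fun x => hP.nonneg x t)
      (fun x => hM' x t) hκ0.ne'
    have hdec := hP.integral_mul_weight_le hγ hκ0 k1 k2 ht
    have hinit : ∫ x, movingFrame v u x 0 * weight κ x ≤ K * W := by
      rw [hW, ← integral_const_mul]
      refine integral_mono (hi 0) (hWi.const_mul K) fun x => ?_
      refine mul_le_mul_of_nonneg_right ?_ (weight_pos κ x).le
      rw [hsol.movingFrame_zero]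
      have := (ENNReal.ofReal_le_ofReal_iff hK0).1 ((weightedNorm_zero_le hα b x).trans hbK)
      exact (le_abs_self _).trans this
    have hdiff : ∫ x, u₀ x * weight κ x ≤
        (∫ x, movingFrame v u x t * weight κ x) + δ * W := by
      rw [hW, ← integral_const_mul, ← integral_add (hi t) (hWi.const_mul δ)]
      refine integral_mono (integrable_mul_weight hc h0 hM hκ0.ne')
        ((hi t).add (hWi.const_mul δ)) fun x => ?_
      have h1 := ((weightedNorm_zero_le hα _ x).trans_lt hclose).le
      rw [ENNReal.ofReal_le_ofReal_iff hδ.le, hψ x, ← movingFrame_of_nonneg v u x ht] at h1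
      have h2 := (le_abs_self _).trans h1
      simp only [← add_mul]
      exact mul_le_mul_of_nonneg_right (by linarith) (weight_pos κ x).le
    have hexp : Real.exp (-(γ / 2 * t)) ≤ Real.exp (-(γ / 2 * s)) :=
      Real.exp_le_exp.2 (neg_le_neg (by gcongr))
    calc _ ≤ _ := hdiff
      _ ≤ Real.exp (-(γ / 2 * t)) * (∫ x, movingFrame v u x 0 * weight κ x) + 2 * V₀ / γ +
          δ * W := by gcongr
      _ ≤ Real.exp (-(γ / 2 * t)) * (K * W) + 2 * V₀ / γ + δ * W := by gcongr
      _ ≤ _ := by gcongr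
  have hlim : Tendsto (fun s : ℝ => Real.exp (-(γ / 2 * s)) * (K * W) + 2 * V₀ / γ + s⁻¹ * W)
      atTop (𝓝 (2 * V₀ / γ)) := by
    have h1 : Tendsto (fun s : ℝ => γ / 2 * s) atTop atTop :=
      Tendsto.const_mul_atTop (by positivity) tendsto_id
    simpa using (((Real.tendsto_exp_neg_atTop_nhds_zero.comp h1).mul_const (K * W)).add_const
      (2 * V₀ / γ)).add (tendsto_inv_atTop_zero.mul_const W)
  -- Choosing `δ = 1/s` and letting `s → ∞` leaves `2 V₀ / γ`, a bound independent of `κ`.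
  refine ge_of_tendsto hlim ?_
  filter_upwards [eventually_gt_atTop 0] with s hs
  exact hbound s hs.le s⁻¹ (inv_pos.2 hs)

end FreeInterface

end

/-! ### Injectivity on the attractor -/

theorem mainTheorem9 (γ v₀ V₀ : ℝ) (hγ : 0 < γ) (hv₀ : 0 < v₀) (hV₀ : 0 < V₀)
    (g : ℝ → ℝ) (hg : FreeInterface.IsKinetics v₀ V₀ g)
    (α : ℝ) (hα : 0 ≤ α) (hα' : α < FreeInterface.alphaMin γ v₀ V₀)
    (ε : ℝ) (hε : 0 < ε) (t : ℝ) (ht : 0 ≤ t)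
    (u₁ u₂ : ℝ → ℝ)
    (hu₁ : u₁ ∈ FreeInterface.attractor γ g V₀ α ε)
    (hu₂ : u₂ ∈ FreeInterface.attractor γ g V₀ α ε)
    (φ : ℝ → ℝ)
    (h₁ : FreeInterface.Evolves γ g t u₁ φ) (h₂ : FreeInterface.Evolves γ g t u₂ φ) :
    u₁ = u₂ := by
  obtain ⟨U₁, v₁, s₁, e₁⟩ := h₁
  obtain ⟨U₂, v₂, s₂, e₂⟩ := h₂
  have p₁ := s₁.isProfile hg hv₀
  have p₂ := s₂.isProfile hg hv₀
  have z₁ := s₁.movingFrame_zero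
  have z₂ := s₂.movingFrame_zero
  -- Nonnegativity of the datum is read off from the solution that starts at it.
  have i₁ := FreeInterface.integrable_of_mem_attractor hγ hv₀ hg hV₀.le hα hε.le
    (fun x => z₁ x ▸ p₁.nonneg x 0) hu₁
  have i₂ := FreeInterface.integrable_of_mem_attractor hγ hv₀ hg hV₀.le hα hε.le
    (fun x => z₂ x ▸ p₂.nonneg x 0) hu₂
  obtain ⟨L, hL⟩ := hg.exists_lipschitz
  funext x
  rw [← z₁ x, ← z₂ x]
  refine p₁.eq_of_eq p₂ hγ (by simpa only [z₁] using i₁) (by simpa only [z₂] using i₂) (L := L)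
    (fun τ hτ => ?_) ht (fun y => ?_) x
  · rw [FreeInterface.movingFrame_of_nonneg v₁ U₁ 0 hτ.le,
      FreeInterface.movingFrame_of_nonneg v₂ U₂ 0 hτ.le, FreeInterface.velocityExt,
      FreeInterface.velocityExt, max_eq_left hτ.le, zero_add, zero_add, ← s₁.kinetic τ hτ,
      ← s₂.kinetic τ hτ]
    exact hL _ _ (s₁.nonneg _ _ hτ.le) (s₂.nonneg _ _ hτ.le)
  · rw [FreeInterface.movingFrame_of_nonneg v₁ U₁ y ht,
      FreeInterface.movingFrame_of_nonneg v₂ U₂ y ht, ← e₁ y, ← e₂ y]
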